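/- Let $K$ be a compact, connected, metrizable space, $S$ a finite set with $\#S\ge 2$ (discrete topology), $\psi_i:K\to K$ ($i\in S$) continuous injections, and $\pi:S^{\mathbb N}\to K$ a continuous surjection with $\psi_i(\pi(\omega))=\pi(i\omega)$ for all $i\in S$ and $\omega\in S^{\mathbb N}$. For a finite word $w=w_1\cdots w_m$ over $S$ (possibly empty) put $\psi_w=\psi_{w_1}\circ\cdots\circ\psi_{w_m}$ and $K_w=\psi_w(K)$. Let $\sigma$ be the left shift on $S^{\mathbb N}$, $\mathcal P=\bigcup_{m\ge1}\sigma^m\bigl(\pi^{-1}(\bigcup_{i\ne j}(K_i\cap K_j))\bigr)$, which is assumed to be finite, $V_0=\pi(\mathcal P)$ and $V_m=\bigcup_{|w|=m}\psi_w(V_0)$. Write $l(V)$ for the real-valued functions on a finite set $V$, with the canonical inner product $(\cdot,\cdot)$. Let $D=(D_{pq})_{p,q\in V_0}$ be a real symmetric non-positive definite matrix with $Du=0$ if and only if $u$ is constant, and $D_{pq}\ge0$ for $p\ne q$; let $0<r_i<1$ ($i\in S$) and $r_w=r_{w_1}\cdots r_{w_m}$. Put $\mathcal E^{(0)}(u,v)=(-Du,v)$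 and $\mathcal E^{(m)}(u,v)=\sum_{|w|=m}r_w^{-1}\mathcal E^{(0)}(u\circ\psi_w|_{V_0},v\circ\psi_w|_{V_0})$, and assume that $\mathcal E^{(0)}(u,u)=\inf\{\mathcal E^{(1)}(v,v): v\in l(V_1),\ v|_{V_0}=u\}$ for all $u\in l(V_0)$ (that is, $(D,(r_i))$ is a regular harmonic structure). Let $\mathcal F=\{u\in C(K):\sup_m\mathcal E^{(m)}(u,u)<\infty\}$ and $\mathcal E(u,v)=\lim_{m\to\infty}\mathcal E^{(m)}(u,v)$ for $u,v\in\mathcal F$. A function $h\in\mathcal F$ is harmonic if it minimizes $\mathcal E(g,g)$ among all $g\in\mathcal F$ with $g|_{V_0}=h|_{V_0}$; $\mathcal H$ is the space of harmonic functions. For $x\in l(V_0)$ let $\iota(x)$ be the unique harmonic function with $\iota(x)|_{V_0}=x$. Define $A_i:l(V_0)\to l(V_0)$ by $(A_ix)(p)=\iota(x)(\psi_i(p))$, put $A_w=A_{w_m}\cdots A_{w_1}$, and $A_wf=A_w(f|_{V_0})$ for $f\in\mathcal H$. For $f\in\mathcal F$ let $\nu_f$ be the energy measure of $f$, the unique finite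 Borel measure on $K$ with $\int_K g\,d\nu_f=2\mathcal E(f,fg)-\mathcal E(f^2,g)$ for all $g\in\mathcal F$. Assume the following. (A1) $S_0\subset S$ is a subset with $\#S_0=\#V_0$ such that every $p\in V_0$ satisfies $\psi_j(p)=p$ for some $j\in S_0$; and $K\setminus\{p\}$ is connected for every $p\in V_0$. (A2) Every $A_i$ ($i\in S$) is invertible. (A3) $D^2=-\gamma D$ for some $\gamma>0$. Let $h_1,\dots,h_N$ be harmonic functions which together with the constants span $\mathcal H$, and let $\nu=\sum_{k=1}^N\nu_{h_k}$. For $j\in S_0$ let $u_j=(D_{qp})_{q\in V_0}$, where $p\in V_0$ is the fixed point of $\psi_j$, and for a finite word $w$ let $a_j^{(w)}=\sum_{k=1}^N(u_j,A_wh_k)^2$. Then for every finite word $w$ the following hold. One has $\nu(K_w)>0$, and for every $f\in\mathcal H$ and $j\in S_0$ the limit $$\frac{d\nu_f}{d\nu}(wj^\infty):=\lim_{n\to\infty}\frac{\nu_f(K_{wj^n})}{\nu(K_{wj^n})}$$ exists in $\mathbb R$, where $wj^n$ is $w$ followed by $n$ letters $j$. The numbers $b_j^{(w)}=a_j^{(w)}\big/\sum_{i\in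 S_0}a_i^{(w)}$ ($j\in S_0$) are well defined and positive, and $$\frac{\nu_f(K_w)}{\nu(K_w)}=\sum_{j\in S_0}b_j^{(w)}\,\frac{d\nu_f}{d\nu}(wj^\infty)\qquad\text{for all }f\in\mathcal H.$$ If $\#V_0\ge3$, then $(b_j^{(w)})_{j\in S_0}$ is the only family of real numbers for which this identity holds for all $f\in\mathcal H$. -/

import Mathlib

open MeasureTheory Filter Topology

noncomputable section

namespace FractalEnergy

/-- The infinite word `i ω₀ ω₁ ω₂ …`, that is, `σ_i ω`. -/
def prepend {S : Type*} (i : S) (ω : ℕ → S) : ℕ → S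
  | 0 => i
  | n + 1 => ω n

/-- A self-similar structure `(K, S, {ψ_i})` with its coding map `π : S^ℕ → K`. The finite set `S`
carries the discrete topology and `ℕ → S` the product topology. -/
structure SelfSimilarStructure (K S : Type*) [TopologicalSpace K] [TopologicalSpace S] where
  ψ : S → K → K
  ψ_continuous : ∀ i, Continuous (ψ i)
  ψ_injective : ∀ i, Function.Injective (ψ i)
  π : (ℕ → S) → K
  π_continuous : Continuous π
  π_surjective : Function.Surjective π
  ψ_π : ∀ i ω, ψ i (π ω) = π (prepend i ω)

namespace SelfSimilarStructure

variable {K S : Type*} [TopologicalSpace K] [TopologicalSpace S] (L : SelfSimilarStructure K S)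

/-- `ψ_w = ψ_{w₁} ∘ ⋯ ∘ ψ_{w_m}` for a finite word `w = w₁ ⋯ w_m`. -/
def ψw (w : List S) : K → K := w.foldr (fun i g => L.ψ i ∘ g) id

/-- `K_w = ψ_w(K)`. -/
def cell (w : List S) : Set K := Set.range (L.ψw w)

/-- The post-critical set `P = ⋃_{m ≥ 1} σ^m (π⁻¹ (⋃_{i ≠ j} K_i ∩ K_j))`. -/
def postCritical : Set (ℕ → S) :=
  ⋃ m ∈ {m : ℕ | 1 ≤ m}, (fun (ω : ℕ → S) (n : ℕ) => ω (n + m)) ''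
    (L.π ⁻¹' {x | ∃ i j : S, i ≠ j ∧ x ∈ Set.range (L.ψ i) ∩ Set.range (L.ψ j)})

/-- The boundary `V₀ = π(P)`. -/
def V₀ : Set K := L.π '' L.postCritical

end SelfSimilarStructure

/-- A post-critically finite self-similar structure. -/
structure PCFStructure (K S : Type*) [TopologicalSpace K] [TopologicalSpace S] extends
    SelfSimilarStructure K S where
  finite_postCritical : toSelfSimilarStructure.postCritical.Finite

variable {K S : Type*} [TopologicalSpace K] [TopologicalSpace S]

instance (L : PCFStructure K S) : Fintype L.V₀ := (L.finite_postCritical.image L.π).fintype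

/-- Restriction of a function on `K` to the cell `w`, read on the boundary: `u ∘ ψ_w |_{V₀}`. -/
def pullV₀ (L : PCFStructure K S) (w : List S) (u : K → ℝ) : L.V₀ → ℝ := fun p => u (L.ψw w p)

/-- `r_w = r_{w₁} ⋯ r_{w_m}`. -/
def wordProd (r : S → ℝ) (w : List S) : ℝ := (w.map r).prod

/-- `𝓔⁽⁰⁾(u, v) = (-Du, v)`. -/
def energyZero {L : PCFStructure K S} (D : Matrix L.V₀ L.V₀ ℝ) (u v : L.V₀ → ℝ) : ℝ :=
  (-(D.mulVec u)) ⬝ᵥ v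

/-- `𝓔⁽ᵐ⁾(u, v) = ∑_{w ∈ S^m} r_w⁻¹ 𝓔⁽⁰⁾(u ∘ ψ_w, v ∘ ψ_w)`. Functions on `V_m = ⋃_w ψ_w(V₀)` are
represented by functions on `K`; only their values on `V_m` enter. -/
def energyLevel [Fintype S] {L : PCFStructure K S} (D : Matrix L.V₀ L.V₀ ℝ) (r : S → ℝ)
    (m : ℕ) (u v : K → ℝ) : ℝ :=
  ∑ w : Fin m → S, (wordProd r (List.ofFn w))⁻¹ *
    energyZero D (pullV₀ L (List.ofFn w) u) (pullV₀ L (List.ofFn w) v)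

/-- A regular harmonic structure `(D, r)`. The infimum in the last field runs over all functions on
`V₁ ⊇ V₀` with boundary values `u` (represented by their extensions to `K`). -/
structure RegularHarmonicStructure [Fintype S] (L : PCFStructure K S) where
  D : Matrix L.V₀ L.V₀ ℝ
  r : S → ℝ
  D_symm : D.IsSymm
  D_nonpos : ∀ u : L.V₀ → ℝ, (D.mulVec u) ⬝ᵥ u ≤ 0
  D_ker : ∀ u : L.V₀ → ℝ, D.mulVec u = 0 ↔ ∃ c : ℝ, ∀ p, u p = c
  D_offdiag : ∀ p q, p ≠ q → 0 ≤ D p q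
  r_pos : ∀ i, 0 < r i
  r_lt_one : ∀ i, r i < 1
  energy_eq : ∀ u : L.V₀ → ℝ,
    IsGLB {e : ℝ | ∃ v : K → ℝ, (∀ p : L.V₀, v p = u p) ∧ e = energyLevel D r 1 v v}
      (energyZero D u u)

namespace RegularHarmonicStructure

variable [Fintype S] {L : PCFStructure K S} (H : RegularHarmonicStructure L)

/-- The domain `𝓕`: continuous functions of finite energy. -/
def domain : Set C(K, ℝ) :=
  {u | BddAbove (Set.range fun m : ℕ => energyLevel H.D H.r m u u)}

/-- The form `𝓔(u, v) = lim_m 𝓔⁽ᵐ⁾(u, v)` (for `u, v ∈ 𝓕`, where the limit exists). -/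
def energy (u v : C(K, ℝ)) : ℝ := limUnder atTop fun m : ℕ => energyLevel H.D H.r m u v

/-- Harmonic functions: energy minimizers in `𝓕` among functions with the same boundary values. -/
def IsHarmonic (h : C(K, ℝ)) : Prop :=
  h ∈ H.domain ∧ ∀ g ∈ H.domain, (∀ p ∈ L.V₀, g p = h p) → H.energy h h ≤ H.energy g g

open Classical in
/-- The map `ι`: the harmonic function with boundary values `x` (it exists and is unique). -/
def harmonicExt (x : L.V₀ → ℝ) : C(K, ℝ) :=
  if hx : ∃ h : C(K, ℝ), H.IsHarmonic h ∧ ∀ p : L.V₀, h p = x p then hx.choose else 0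

/-- `(A_i x)(p) = (ι x)(ψ_i p)`. -/
def A (i : S) (x : L.V₀ → ℝ) : L.V₀ → ℝ := fun p => H.harmonicExt x (L.ψ i p)

/-- `A_w = A_{w_m} ⋯ A_{w₁}`. -/
def Aw (w : List S) (x : L.V₀ → ℝ) : L.V₀ → ℝ := w.foldl (fun y i => H.A i y) x

/-- `μ` is an energy measure of `f`: a finite Borel measure with
`∫ g dμ = 2 𝓔(f, f g) - 𝓔(f², g)` for all `g ∈ 𝓕`. -/
def IsEnergyMeasure [MeasurableSpace K] (f : C(K, ℝ)) (μ : Measure K) : Prop :=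
  IsFiniteMeasure μ ∧
    ∀ g ∈ H.domain, ∫ x, g x ∂μ = 2 * H.energy f (f * g) - H.energy (f * f) g

open Classical in
/-- The energy measure `ν_f` (it exists and is unique for `f ∈ 𝓕`). -/
def energyMeasure [MeasurableSpace K] (f : C(K, ℝ)) : Measure K :=
  if hf : ∃ μ : Measure K, H.IsEnergyMeasure f μ then hf.choose else 0

/-- `ν = ∑_k ν_{h_k}`. -/
def sumMeasure [MeasurableSpace K] {N : ℕ} (h : Fin N → C(K, ℝ)) : Measure K :=
  ∑ k, H.energyMeasure (h k)

/-- The ratio `ν_f(K_w) / ν(K_w)`. -/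
def ratio [MeasurableSpace K] {N : ℕ} (h : Fin N → C(K, ℝ)) (f : C(K, ℝ)) (w : List S) : ℝ :=
  (H.energyMeasure f).real (L.cell w) / (H.sumMeasure h).real (L.cell w)

/-- `(dν_f/dν)(w j^∞) = lim_n ν_f(K_{w j^n}) / ν(K_{w j^n})`. -/
def density [MeasurableSpace K] {N : ℕ} (h : Fin N → C(K, ℝ)) (f : C(K, ℝ)) (w : List S)
    (j : S) : ℝ :=
  limUnder atTop fun n : ℕ => H.ratio h f (w ++ List.replicate n j)

open Classical in
/-- The column `u_j = (D_{q p})_q` of `D`, where `p ∈ V₀` is the fixed point of `ψ_j`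
(zero if `ψ_j` has no fixed point in `V₀`). -/
def u (j : S) : L.V₀ → ℝ :=
  if hj : ∃ p : L.V₀, L.ψ j p = p then fun q => H.D q hj.choose else 0

/-- `a_j^{(w)} = ∑_k (u_j, A_w h_k)²`. -/
def a {N : ℕ} (h : Fin N → C(K, ℝ)) (w : List S) (j : S) : ℝ :=
  ∑ k, (H.u j ⬝ᵥ H.Aw w (fun p => h k p)) ^ 2

end RegularHarmonicStructure

end FractalEnergy

end

/-!
By `D² = -γ D` and the description of its kernel, `D` is the Laplacian of the complete graph on `V₀`
with one constant conductance `κ`; hence `𝓔⁽⁰⁾(x, x) = γ⁻¹ ∑_p (D x)(p)²`, a sum of squared normal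
derivatives. The energy measure of a harmonic function `f` gives the cell `K_w` the mass
`2 r_w⁻¹ 𝓔⁽⁰⁾(A_w f, A_w f)` (`measureReal_cell`), so `ν_f(K_w) / ν(K_w)` is the quotient of
`∑_j (u_j, A_w f)²` by `∑_j a_j^{(w)}`. Along `w j^n` the same quotient is governed by the powers of
`A_j`: off the fixed point `p` of `ψ_j` this is a strictly positive matrix all of whose columns have
sum `r_j`, so Doeblin's argument gives `r_j^{-n} (A_j^n x - x(p)) → c (u_j, x) v` with a vector `v`
that does not depend on `x` (`exists_tendsto_pow`). The density at `w j^∞` is therefore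
`(u_j, A_w f)² / a_j^{(w)}` (`tendsto_ratio`), and the weights `b_j` put the squares together again.
Invertibility of the `A_i` makes `A_w f` arbitrary, which gives `a_j^{(w)} > 0` and, since the forms
`(u_j, ·)²` are linearly independent when `V₀` has at least three points, uniqueness of the weights.

The analysis behind this is simplified by one observation: a boundary point fixed by `ψ_j` has the
single code `j^∞` (`code_unique`), as otherwise the post-critical set would be infinite. A boundary
point thus lies in exactly one cell of each level. This makes the strong minimum principle on `V₁`
available, lets functions prescribed on cells be glued along boundary values, and shows that
cells of level `n` that meet another cell of level `m ≤ n` without being nested in it have the form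
`v j^{n-m}` with `|v| = m`, so that their total energy tends to `0`; this is what the cut-off
argument for `measureReal_cell` needs. Harmonic functions are built on the code space as limits of
iterated discrete harmonic extensions, whose oscillation decays because all `r_i < 1`; energy
measures exist by the Riesz–Markov–Kakutani theorem, as limit points of the discrete measures `carre`.
-/

noncomputable section

namespace FractalEnergy

/-! ### Words, cells and codes -/

namespace SelfSimilarStructure

section Words

variable {S : Type*}

/-- The infinite word `w ω` obtained by writing the finite word `w` in front of `ω`. -/
def prependWord (w : List S) (ω : ℕ → S) : ℕ → S := w.foldr prepend ω

/-- The prefix of length `n` of an infinite word. -/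
def prefixWord : ℕ → (ℕ → S) → List S
  | 0, _ => []
  | n + 1, ω => ω 0 :: prefixWord n fun k => ω (k + 1)

lemma prepend_head_tail (ω : ℕ → S) : prepend (ω 0) (fun k => ω (k + 1)) = ω := by
  funext n
  cases n <;> rfl

lemma prependWord_add_length (w : List S) (ω : ℕ → S) (n : ℕ) :
    prependWord w ω (n + w.length) = ω n := by
  induction w with
  | nil => rfl
  | cons i w ih => exact ih

lemma prependWord_prefixWord_of_lt {n k : ℕ} (hk : k < n) (ω τ : ℕ → S) :
    prependWord (prefixWord n ω) τ k = ω k := by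
  induction n generalizing k ω with
  | zero => omega
  | succ n ih =>
    cases k with
    | zero => rfl
    | succ k => exact ih (by omega) _

@[simp] lemma length_prefixWord (n : ℕ) (ω : ℕ → S) : (prefixWord n ω).length = n := by
  induction n generalizing ω with
  | zero => rfl
  | succ n ih => simp [prefixWord, ih]

lemma prefixWord_const (n : ℕ) (j : S) : prefixWord n (fun _ => j) = List.replicate n j := by
  induction n with
  | zero => rfl
  | succ n ih => simp [prefixWord, ih, List.replicate_succ]

lemma eq_replicate_of_prependWord_eq_const {j : S} (w : List S) (ω : ℕ → S)
    (h : prependWord w ω = fun _ => j) : w = List.replicate w.length j := by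
  induction w with
  | nil => rfl
  | cons i w ih =>
    have h0 : i = j := congrFun h 0
    have h1 : prependWord w ω = fun _ => j := funext fun n => congrFun h (n + 1)
    rw [List.length_cons, List.replicate_succ, ← ih h1, h0]

lemma tendsto_prependWord_prefixWord [TopologicalSpace S] (ω : ℕ → S) (τ : ℕ → ℕ → S) :
    Tendsto (fun n => prependWord (prefixWord n ω) (τ n)) atTop (𝓝 ω) := by
  refine tendsto_pi_nhds.2 fun k => tendsto_const_nhds.congr' ?_
  filter_upwards [eventually_gt_atTop k] with n hn
  exact (prependWord_prefixWord_of_lt hn _ _).symm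

end Words

variable {K S : Type*} [TopologicalSpace K] [TopologicalSpace S] (L : SelfSimilarStructure K S)

@[simp] lemma ψw_nil (x : K) : L.ψw [] x = x := rfl

@[simp] lemma ψw_cons (i : S) (w : List S) (x : K) : L.ψw (i :: w) x = L.ψ i (L.ψw w x) := rfl

lemma ψw_append (v w : List S) (x : K) : L.ψw (v ++ w) x = L.ψw v (L.ψw w x) := by
  induction v with
  | nil => rfl
  | cons i v ih => simp [ih]

lemma ψw_continuous (w : List S) : Continuous (L.ψw w) := by
  induction w with
  | nil => exact continuous_id
  | cons i w ih => exact (L.ψ_continuous i).comp ih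

lemma ψw_π (w : List S) (ω : ℕ → S) : L.ψw w (L.π ω) = L.π (prependWord w ω) := by
  induction w with
  | nil => rfl
  | cons i w ih => rw [ψw_cons, ih, L.ψ_π]; rfl

lemma exists_ψ_eq (x : K) : ∃ i y, L.ψ i y = x := by
  obtain ⟨ω, rfl⟩ := L.π_surjective x
  exact ⟨ω 0, L.π fun k => ω (k + 1), by rw [L.ψ_π, prepend_head_tail]⟩

lemma exists_ψw_eq (n : ℕ) (x : K) : ∃ w y, w.length = n ∧ L.ψw w y = x := by
  induction n generalizing x with
  | zero => exact ⟨[], x, rfl, rfl⟩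
  | succ n ih =>
    obtain ⟨i, y, rfl⟩ := L.exists_ψ_eq x
    obtain ⟨w, z, hw, rfl⟩ := ih y
    exact ⟨i :: w, z, by simp [hw], rfl⟩

lemma tendsto_ψw_prefixWord (ω : ℕ → S) (x : K) :
    Tendsto (fun n => L.ψw (prefixWord n ω) x) atTop (𝓝 (L.π ω)) := by
  obtain ⟨τ, rfl⟩ := L.π_surjective x
  simp_rw [L.ψw_π]
  exact (L.π_continuous.tendsto ω).comp (tendsto_prependWord_prefixWord ω fun _ => τ)

lemma ψw_replicate_of_fixed {j : S} {p : K} (hp : L.ψ j p = p) (n : ℕ) :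
    L.ψw (List.replicate n j) p = p := by
  induction n with
  | zero => rfl
  | succ n ih => rw [List.replicate_succ, ψw_cons, ih, hp]

lemma π_const_of_fixed [T2Space K] {j : S} {p : K} (hp : L.ψ j p = p) : L.π (fun _ => j) = p := by
  refine tendsto_nhds_unique (L.tendsto_ψw_prefixWord (fun _ => j) p) ?_
  simp_rw [prefixWord_const, L.ψw_replicate_of_fixed hp]
  exact tendsto_const_nhds

lemma fixed_unique [T2Space K] {j : S} {p q : K} (hp : L.ψ j p = p) (hq : L.ψ j q = q) :
    p = q := by
  rw [← L.π_const_of_fixed hp, L.π_const_of_fixed hq]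

/-- Every code of a point of `K_i ∩ K_j`, `i ≠ j`, has all its proper shifts post-critical. -/
lemma mem_postCritical_of_mem_inter {ω : ℕ → S} {i j : S} (hij : i ≠ j)
    (h : L.π ω ∈ Set.range (L.ψ i) ∩ Set.range (L.ψ j)) {m : ℕ} (hm : 1 ≤ m) :
    (fun n => ω (n + m)) ∈ L.postCritical :=
  Set.mem_iUnion₂.2 ⟨m, hm, ω, ⟨i, j, hij, h⟩, rfl⟩

/-- Two distinct cells of the same level meet only in boundary points. -/
lemma mem_V₀_of_ψw_eq {v w : List S} (hlen : v.length = w.length) (hne : v ≠ w) {x y : K}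
    (h : L.ψw v x = L.ψw w y) : x ∈ L.V₀ := by
  induction v generalizing w with
  | nil => exact absurd (List.length_eq_zero_iff.1 hlen.symm).symm hne
  | cons i v ih =>
    cases w with
    | nil => simp at hlen
    | cons j w =>
      rw [ψw_cons, ψw_cons] at h
      by_cases hij : i = j
      · subst hij
        exact ih (by simpa using hlen) (fun h' => hne (by rw [h'])) (L.ψ_injective i h)
      · obtain ⟨ω, rfl⟩ := L.π_surjective x
        refine ⟨ω, ?_, rfl⟩
        have hπ : L.π (prependWord (i :: v) ω) ∈ Set.range (L.ψ i) ∩ Set.range (L.ψ j) := by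
          rw [← L.ψw_π, ψw_cons]
          exact ⟨⟨_, rfl⟩, ⟨_, h.symm⟩⟩
        have := L.mem_postCritical_of_mem_inter hij hπ (m := (i :: v).length) (by simp)
        simpa only [prependWord_add_length] using this

lemma mem_V₀_of_ψ_eq {i j : S} (hne : i ≠ j) {x y : K} (h : L.ψ i x = L.ψ j y) : x ∈ L.V₀ :=
  L.mem_V₀_of_ψw_eq (v := [i]) (w := [j]) rfl (by simpa using hne) h

lemma isQuotientMap_π [CompactSpace K] [T2Space K] [Finite S] : IsQuotientMap L.π :=
  IsQuotientMap.of_surjective_continuous L.π_surjective L.π_continuous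

/-- Since `K` is connected, so is the adjacency graph of its level-one cells. -/
lemma cells_connected [CompactSpace K] [T2Space K] [PreconnectedSpace K] [Finite S]
    (T : Set S) (hT : T.Nonempty)
    (hadj : ∀ i ∈ T, ∀ j, j ≠ i → ∀ x y, L.ψ i x = L.ψ j y → j ∈ T) (j : S) : j ∈ T := by
  obtain ⟨i, hi⟩ := hT
  have hclosed : ∀ U : Set S, IsClosed (⋃ k ∈ U, Set.range (L.ψ k)) := fun U =>
    U.toFinite.isClosed_biUnion fun k _ => (isCompact_range (L.ψ_continuous k)).isClosed
  have hcompl : (⋃ k ∈ T, Set.range (L.ψ k))ᶜ = ⋃ k ∈ Tᶜ, Set.range (L.ψ k) := by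
    ext x
    simp only [Set.mem_compl_iff, Set.mem_iUnion, Set.mem_range, exists_prop, not_exists, not_and]
    constructor
    · intro h
      obtain ⟨k, y, rfl⟩ := L.exists_ψ_eq x
      exact ⟨k, fun hk => h k hk y rfl, y, rfl⟩
    · rintro ⟨k, hk, y, rfl⟩ l hl z hz
      exact hk (hadj l hl k (fun h => hk (h ▸ hl)) z y hz)
  have hclopen : IsClopen (⋃ k ∈ T, Set.range (L.ψ k)) :=
    ⟨hclosed T, isClosed_compl_iff.1 (hcompl ▸ hclosed Tᶜ)⟩
  have hx : Nonempty K := by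
    obtain ⟨ω⟩ : Nonempty (ℕ → S) := ⟨fun _ => i⟩
    exact ⟨L.π ω⟩
  obtain ⟨x⟩ := hx
  rcases isClopen_iff.1 hclopen with h | h
  · exact absurd (h ▸ Set.mem_biUnion hi ⟨x, rfl⟩ : L.ψ i x ∈ (∅ : Set K)) (Set.notMem_empty _)
  · by_contra hj
    have h1 : L.ψ j x ∈ (⋃ k ∈ T, Set.range (L.ψ k))ᶜ := by
      rw [hcompl]
      exact Set.mem_biUnion hj ⟨x, rfl⟩
    exact h1 (h ▸ Set.mem_univ _)

end SelfSimilarStructure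

namespace PCFStructure

open SelfSimilarStructure

variable {K S : Type*} [TopologicalSpace K] [TopologicalSpace S] (L : PCFStructure K S)

/-- A fixed point `p` of `ψ_j` has the single code `j^∞`: if `ω` were another code, with
`ω₀ ≠ j` after cancelling leading letters `j`, then all `j^n ω` would be codes of the point `p` of
`K_j ∩ K_{ω₀}`, which makes infinitely many post-critical words. -/
lemma code_unique {j : S} {p : K} (hp : L.ψ j p = p) {ω : ℕ → S} (hω : L.π ω = p) :
    ω = fun _ => j := by
  have key : ∀ τ : ℕ → S, L.π τ = p → τ 0 = j := by
    intro τ hτ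
    by_contra hne
    have hcode : ∀ n, L.π (prependWord (List.replicate n j) τ) = p := fun n => by
      rw [← L.ψw_π, hτ, L.ψw_replicate_of_fixed hp]
    have hτ' : p ∈ Set.range (L.ψ j) ∩ Set.range (L.ψ (τ 0)) :=
      ⟨⟨p, hp⟩, ⟨L.π fun k => τ (k + 1), by rw [L.ψ_π, prepend_head_tail, hτ]⟩⟩
    have hmem : ∀ n, prependWord (List.replicate n j) τ ∈ L.postCritical := fun n =>
      L.mem_postCritical_of_mem_inter (ω := prependWord (List.replicate (n + 1) j) τ)
        (Ne.symm hne) (by rw [hcode]; exact hτ') le_rfl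
    have hval : ∀ n k, prependWord (List.replicate n j) τ (k + n) = τ k := fun n k => by
      simpa using prependWord_add_length (List.replicate n j) τ k
    have hlt : ∀ n k, k < n → prependWord (List.replicate n j) τ k = j := fun n k hk => by
      rw [← prefixWord_const]
      exact prependWord_prefixWord_of_lt hk _ _
    refine Set.infinite_of_injective_forall_mem (f := fun n => prependWord (List.replicate n j) τ)
      (fun m n hmn => ?_) hmem L.finite_postCritical
    by_contra hmn'
    rcases lt_or_gt_of_ne hmn' with h | h
    · have := congrFun hmn m
      simp only [hlt n m h] at this
      exact hne (by rw [← this]; simpa using (hval m 0).symm)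
    · have := congrFun hmn n
      simp only [hlt m n h] at this
      exact hne (by rw [this]; simpa using (hval n 0).symm)
  funext n
  induction n generalizing ω with
  | zero => exact key ω hω
  | succ n ih =>
    refine ih (ω := fun k => ω (k + 1)) (L.ψ_injective j ?_)
    rw [L.ψ_π, hp, ← hω, ← key ω hω, prepend_head_tail]

lemma eq_of_ψ_eq_fixed {j : S} {p : K} (hp : L.ψ j p = p) {i : S} {x : K} (h : L.ψ i x = p) :
    i = j := by
  obtain ⟨ω, rfl⟩ := L.π_surjective x
  rw [L.ψ_π] at h
  exact congrFun (L.code_unique hp h) 0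

lemma eq_replicate_of_ψw_eq_fixed {j : S} {p : K} (hp : L.ψ j p = p) {w : List S} {x : K}
    (h : L.ψw w x = p) : w = List.replicate w.length j := by
  obtain ⟨ω, rfl⟩ := L.π_surjective x
  rw [L.ψw_π] at h
  exact eq_replicate_of_prependWord_eq_const w ω (L.code_unique hp h)

/-- The boundary of a connected structure with at least two cells, whose boundary points are fixed
points, has at least two points: a single boundary point would lie in one cell only, which would
then be disjoint from the others. -/
lemma nontrivial_V₀ [CompactSpace K] [T2Space K] [PreconnectedSpace K] [Nontrivial S] [Finite S]
    (hfix : ∀ p ∈ L.V₀, ∃ j, L.ψ j p = p) : Nontrivial L.V₀ := by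
  by_contra hcon
  rw [not_nontrivial_iff_subsingleton] at hcon
  have key : ∀ i₀ : S, (∀ p ∈ L.V₀, L.ψ i₀ p = p) → False := by
    intro i₀ h₀
    obtain ⟨l, hl⟩ := exists_ne i₀
    refine hl (L.cells_connected {i₀} ⟨i₀, rfl⟩ ?_ l)
    rintro i rfl j hj x y hxy
    have hx : x ∈ L.V₀ := L.mem_V₀_of_ψ_eq hj.symm hxy
    exact L.eq_of_ψ_eq_fixed (h₀ x hx) (hxy.symm.trans (h₀ x hx))
  rcases isEmpty_or_nonempty L.V₀ with h | ⟨⟨p, hp⟩⟩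
  · obtain ⟨i₀⟩ : Nonempty S := inferInstance
    exact key i₀ fun p hp => (h.false ⟨p, hp⟩).elim
  · obtain ⟨j, hj⟩ := hfix p hp
    refine key j fun q hq => ?_
    have : (⟨q, hq⟩ : L.V₀) = ⟨p, hp⟩ := Subsingleton.elim _ _
    rw [Subtype.mk.injEq] at this
    rw [this, hj]

end PCFStructure

/-! ### Sums over words and approximating energies -/

section WordSum

variable {S : Type*} [Fintype S]

/-- The sum of `F w` over all words `w` of length `n`. -/
def wordSum (n : ℕ) (F : List S → ℝ) : ℝ := ∑ w : Fin n → S, F (List.ofFn w)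

@[simp] lemma wordSum_zero (F : List S → ℝ) : wordSum 0 F = F [] := by
  simp [wordSum]

lemma wordSum_succ (n : ℕ) (F : List S → ℝ) :
    wordSum (n + 1) F = ∑ i, wordSum n fun w => F (i :: w) := by
  unfold wordSum
  rw [← (Fin.consEquiv fun _ => S).sum_comp, Fintype.sum_prod_type]
  simp [Fin.consEquiv, List.ofFn_succ]

lemma wordSum_add_length (m n : ℕ) (F : List S → ℝ) :
    wordSum (m + n) F = wordSum m fun v => wordSum n fun w => F (v ++ w) := by
  induction m generalizing F with
  | zero => simp
  | succ m ih => rw [Nat.add_right_comm, wordSum_succ, wordSum_succ]; simp [ih]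

lemma wordSum_congr {n : ℕ} {F G : List S → ℝ} (h : ∀ w, w.length = n → F w = G w) :
    wordSum n F = wordSum n G :=
  Finset.sum_congr rfl fun w _ => h _ (by simp)

lemma wordSum_le {n : ℕ} {F G : List S → ℝ} (h : ∀ w, w.length = n → F w ≤ G w) :
    wordSum n F ≤ wordSum n G :=
  Finset.sum_le_sum fun w _ => h _ (by simp)

lemma wordSum_nonneg {n : ℕ} {F : List S → ℝ} (h : ∀ w, w.length = n → 0 ≤ F w) :
    0 ≤ wordSum n F :=
  Finset.sum_nonneg fun w _ => h _ (by simp)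

lemma le_wordSum {F : List S → ℝ} (h : ∀ w, 0 ≤ F w) (w : List S) : F w ≤ wordSum w.length F := by
  have := Finset.single_le_sum (f := fun v : Fin w.length → S => F (List.ofFn v))
    (fun v _ => h _) (Finset.mem_univ w.get)
  simpa [wordSum] using this

lemma wordSum_add (n : ℕ) (F G : List S → ℝ) :
    wordSum n (fun w => F w + G w) = wordSum n F + wordSum n G := Finset.sum_add_distrib

lemma wordSum_sub (n : ℕ) (F G : List S → ℝ) :
    wordSum n (fun w => F w - G w) = wordSum n F - wordSum n G := Finset.sum_sub_distrib _ _

lemma wordSum_mul (n : ℕ) (c : ℝ) (F : List S → ℝ) :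
    wordSum n (fun w => c * F w) = c * wordSum n F := (Finset.mul_sum _ _ _).symm

end WordSum

@[simp] lemma wordProd_nil {S : Type*} (r : S → ℝ) : wordProd r [] = 1 := rfl

@[simp] lemma wordProd_cons {S : Type*} (r : S → ℝ) (i : S) (w : List S) :
    wordProd r (i :: w) = r i * wordProd r w := by simp [wordProd]

lemma wordProd_append {S : Type*} (r : S → ℝ) (v w : List S) :
    wordProd r (v ++ w) = wordProd r v * wordProd r w := by simp [wordProd]

lemma wordProd_replicate {S : Type*} (r : S → ℝ) (n : ℕ) (i : S) :
    wordProd r (List.replicate n i) = r i ^ n := by simp [wordProd]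

section EnergyZero

variable {K S : Type*} [TopologicalSpace K] [TopologicalSpace S] {L : PCFStructure K S}
  (D : Matrix L.V₀ L.V₀ ℝ)

lemma energyZero_add_left (x y z : L.V₀ → ℝ) :
    energyZero D (x + y) z = energyZero D x z + energyZero D y z := by
  simp [energyZero, Matrix.mulVec_add, add_dotProduct]
  ring

lemma energyZero_add_right (x y z : L.V₀ → ℝ) :
    energyZero D x (y + z) = energyZero D x y + energyZero D x z := by
  simp only [energyZero, dotProduct_add]

lemma energyZero_smul_left (c : ℝ) (x y : L.V₀ → ℝ) :
    energyZero D (c • x) y = c * energyZero D x y := by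
  simp [energyZero, Matrix.mulVec_smul, smul_dotProduct]

lemma energyZero_smul_right (c : ℝ) (x y : L.V₀ → ℝ) :
    energyZero D x (c • y) = c * energyZero D x y := by
  simp [energyZero, dotProduct_smul]

variable [Fintype S] (r : S → ℝ)

lemma energyLevel_eq_wordSum (m : ℕ) (u v : K → ℝ) :
    energyLevel D r m u v = wordSum m fun w =>
      (wordProd r w)⁻¹ * energyZero D (pullV₀ L w u) (pullV₀ L w v) := rfl

@[simp] lemma energyLevel_zero (u v : K → ℝ) :
    energyLevel D r 0 u v = energyZero D (fun p => u p) (fun p => v p) := by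
  rw [energyLevel_eq_wordSum, wordSum_zero, wordProd_nil, inv_one, one_mul]; rfl

lemma energyLevel_succ (m : ℕ) (u v : K → ℝ) :
    energyLevel D r (m + 1) u v =
      ∑ i, (r i)⁻¹ * energyLevel D r m (u ∘ L.ψ i) (v ∘ L.ψ i) := by
  simp_rw [energyLevel_eq_wordSum, wordSum_succ, wordProd_cons, mul_inv, mul_assoc, wordSum_mul]
  rfl

lemma energyLevel_one (u v : K → ℝ) :
    energyLevel D r 1 u v =
      ∑ i, (r i)⁻¹ * energyZero D (fun p => u (L.ψ i p)) (fun p => v (L.ψ i p)) := by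
  rw [energyLevel_succ]
  simp

lemma energyLevel_add_left (m : ℕ) (u v w : K → ℝ) :
    energyLevel D r m (u + v) w = energyLevel D r m u w + energyLevel D r m v w := by
  simp_rw [energyLevel_eq_wordSum, ← wordSum_add, ← mul_add, ← energyZero_add_left]
  rfl

lemma energyLevel_add_right (m : ℕ) (u v w : K → ℝ) :
    energyLevel D r m u (v + w) = energyLevel D r m u v + energyLevel D r m u w := by
  simp_rw [energyLevel_eq_wordSum, ← wordSum_add, ← mul_add, ← energyZero_add_right]
  rfl

lemma energyLevel_smul_left (m : ℕ) (c : ℝ) (u v : K → ℝ) :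
    energyLevel D r m (c • u) v = c * energyLevel D r m u v := by
  simp_rw [energyLevel_eq_wordSum, ← wordSum_mul, mul_left_comm c, ← energyZero_smul_left]
  rfl

lemma energyLevel_smul_right (m : ℕ) (c : ℝ) (u v : K → ℝ) :
    energyLevel D r m u (c • v) = c * energyLevel D r m u v := by
  simp_rw [energyLevel_eq_wordSum, ← wordSum_mul, mul_left_comm c, ← energyZero_smul_right]
  rfl

end EnergyZero

namespace RegularHarmonicStructure

variable {K S : Type*} [TopologicalSpace K] [TopologicalSpace S] [Fintype S] {L : PCFStructure K S}
  (H : RegularHarmonicStructure L)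

lemma energyZero_comm (x y : L.V₀ → ℝ) : energyZero H.D x y = energyZero H.D y x := by
  simp only [energyZero, neg_dotProduct]
  rw [dotProduct_comm, Matrix.dotProduct_mulVec, ← Matrix.mulVec_transpose, H.D_symm.eq]

lemma energyZero_self_nonneg (x : L.V₀ → ℝ) : 0 ≤ energyZero H.D x x := by
  have := H.D_nonpos x
  simp only [energyZero, neg_dotProduct]
  linarith

lemma energyLevel_comm (m : ℕ) (u v : K → ℝ) :
    energyLevel H.D H.r m u v = energyLevel H.D H.r m v u := by
  simp_rw [energyLevel_eq_wordSum, H.energyZero_comm]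

lemma wordProd_pos (w : List S) : 0 < wordProd H.r w := by
  induction w with
  | nil => simp
  | cons i w ih => rw [wordProd_cons]; exact mul_pos (H.r_pos i) ih

lemma energyLevel_self_nonneg (m : ℕ) (u : K → ℝ) : 0 ≤ energyLevel H.D H.r m u u :=
  wordSum_nonneg (F := fun w => (wordProd H.r w)⁻¹ *
    energyZero H.D (pullV₀ L w u) (pullV₀ L w u)) fun w _ =>
    mul_nonneg (inv_nonneg.2 (H.wordProd_pos w).le) (H.energyZero_self_nonneg _)

lemma energyZero_le_energyLevel_one (u : K → ℝ) :
    energyZero H.D (fun p => u p) (fun p => u p) ≤ energyLevel H.D H.r 1 u u :=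
  (H.energy_eq _).1 ⟨u, fun _ => rfl, rfl⟩

lemma energyLevel_le_succ (m : ℕ) (u : K → ℝ) :
    energyLevel H.D H.r m u u ≤ energyLevel H.D H.r (m + 1) u u := by
  induction m generalizing u with
  | zero => rw [energyLevel_zero]; exact H.energyZero_le_energyLevel_one u
  | succ m ih =>
    rw [energyLevel_succ, energyLevel_succ _ _ (m + 1)]
    exact Finset.sum_le_sum fun i _ =>
      mul_le_mul_of_nonneg_left (ih _) (inv_nonneg.2 (H.r_pos i).le)

lemma energyLevel_mono (u : K → ℝ) : Monotone fun m => energyLevel H.D H.r m u u :=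
  monotone_nat_of_le_succ fun m => H.energyLevel_le_succ m u

/-! ### The form domain -/

lemma energy_tendsto_self {u : C(K, ℝ)} (hu : u ∈ H.domain) :
    Tendsto (fun m => energyLevel H.D H.r m u u) atTop (𝓝 (H.energy u u)) :=
  tendsto_nhds_limUnder ⟨_, tendsto_atTop_ciSup (H.energyLevel_mono u) hu⟩

lemma energyLevel_le_energy {u : C(K, ℝ)} (hu : u ∈ H.domain) (m : ℕ) :
    energyLevel H.D H.r m u u ≤ H.energy u u :=
  (H.energyLevel_mono u).ge_of_tendsto (H.energy_tendsto_self hu) m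

lemma mem_domain_of_eventually_le {u : C(K, ℝ)} (m : ℕ) (C : ℝ)
    (h : ∀ n, energyLevel H.D H.r (m + n) u u ≤ C) : u ∈ H.domain := by
  refine ⟨C, ?_⟩
  rintro _ ⟨n, rfl⟩
  exact (H.energyLevel_mono u (Nat.le_add_left n m)).trans (h n)

lemma energyLevel_add_self (m : ℕ) (u v : K → ℝ) :
    energyLevel H.D H.r m (u + v) (u + v) = energyLevel H.D H.r m u u +
      2 * energyLevel H.D H.r m u v + energyLevel H.D H.r m v v := by
  rw [energyLevel_add_left, energyLevel_add_right, energyLevel_add_right,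
    H.energyLevel_comm m v u]
  ring

lemma add_mem_domain {u v : C(K, ℝ)} (hu : u ∈ H.domain) (hv : v ∈ H.domain) :
    u + v ∈ H.domain := by
  refine H.mem_domain_of_eventually_le 0 (2 * H.energy u u + 2 * H.energy v v) fun n => ?_
  have h1 := H.energyLevel_add_self (0 + n) u v
  have h2 := H.energyLevel_add_self (0 + n) u ((-1 : ℝ) • (v : K → ℝ))
  have h3 := H.energyLevel_self_nonneg (0 + n) (u + (-1 : ℝ) • (v : K → ℝ))
  simp only [energyLevel_smul_left, energyLevel_smul_right] at h2
  have h4 := H.energyLevel_le_energy hu (0 + n)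
  have h5 := H.energyLevel_le_energy hv (0 + n)
  rw [ContinuousMap.coe_add]
  linarith

lemma energy_tendsto {u v : C(K, ℝ)} (hu : u ∈ H.domain) (hv : v ∈ H.domain) :
    Tendsto (fun m => energyLevel H.D H.r m u v) atTop (𝓝 (H.energy u v)) := by
  refine tendsto_nhds_limUnder
    ⟨(H.energy (u + v) (u + v) - H.energy u u - H.energy v v) / 2, ?_⟩
  refine ((((H.energy_tendsto_self (H.add_mem_domain hu hv)).sub
    (H.energy_tendsto_self hu)).sub (H.energy_tendsto_self hv)).div_const 2).congr fun m => ?_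
  rw [ContinuousMap.coe_add, H.energyLevel_add_self]
  ring

/-- The standing situation of the argument: boundary points are fixed points of maps `ψ_j`, and
the form `𝓔⁽⁰⁾` is that of the complete graph on `V₀` with constant conductance `κ`, which is
what `D² = -γ D` amounts to. -/
structure IsComplete (H : RegularHarmonicStructure L) (κ : ℝ) : Prop where
  pos : 0 < κ
  energyZero_eq : ∀ x y : L.V₀ → ℝ,
    energyZero H.D x y = κ / 2 * ∑ p, ∑ q, (x p - x q) * (y p - y q)
  fixed : ∀ p ∈ L.V₀, ∃ j, L.ψ j p = p

variable {H} {κ : ℝ}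

namespace IsComplete

lemma energyZero_mul_le (hH : H.IsComplete κ) {x y : L.V₀ → ℝ} {A B : ℝ} (hx : ∀ p, |x p| ≤ A)
    (hy : ∀ p, |y p| ≤ B) :
    energyZero H.D (x * y) (x * y) ≤
      2 * A ^ 2 * energyZero H.D y y + 2 * B ^ 2 * energyZero H.D x x := by
  have key : ∑ p, ∑ q, ((x * y) p - (x * y) q) * ((x * y) p - (x * y) q) ≤
      ∑ p, ∑ q, (2 * A ^ 2 * ((y p - y q) * (y p - y q)) +
        2 * B ^ 2 * ((x p - x q) * (x p - x q))) := by
    refine Finset.sum_le_sum fun p _ => Finset.sum_le_sum fun q _ => ?_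
    have h1 : x p ^ 2 ≤ A ^ 2 := sq_le_sq' (abs_le.1 (hx p)).1 (abs_le.1 (hx p)).2
    have h2 : y q ^ 2 ≤ B ^ 2 := sq_le_sq' (abs_le.1 (hy q)).1 (abs_le.1 (hy q)).2
    have h3 := mul_le_mul_of_nonneg_right h1 (sq_nonneg (y p - y q))
    have h4 := mul_le_mul_of_nonneg_right h2 (sq_nonneg (x p - x q))
    simp only [Pi.mul_apply]
    nlinarith [sq_nonneg (x p * (y p - y q) - y q * (x p - x q))]
  simp only [Finset.sum_add_distrib, ← Finset.mul_sum] at key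
  have := mul_le_mul_of_nonneg_left key (div_pos hH.pos two_pos).le
  rw [hH.energyZero_eq, hH.energyZero_eq, hH.energyZero_eq]
  linarith

/-- `𝓕` is an algebra. -/
lemma mul_mem_domain [CompactSpace K] (hH : H.IsComplete κ) {u v : C(K, ℝ)} (hu : u ∈ H.domain)
    (hv : v ∈ H.domain) : u * v ∈ H.domain := by
  refine H.mem_domain_of_eventually_le 0
    (2 * ‖u‖ ^ 2 * H.energy v v + 2 * ‖v‖ ^ 2 * H.energy u u) fun n => ?_
  have h1 := mul_le_mul_of_nonneg_left (H.energyLevel_le_energy hu (0 + n))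
    (by positivity : 0 ≤ 2 * ‖v‖ ^ 2)
  have h2 := mul_le_mul_of_nonneg_left (H.energyLevel_le_energy hv (0 + n))
    (by positivity : 0 ≤ 2 * ‖u‖ ^ 2)
  refine le_trans ?_ (add_le_add h2 h1)
  simp_rw [energyLevel_eq_wordSum, ← wordSum_mul, ← wordSum_add]
  refine wordSum_le fun w _ => ?_
  have := mul_le_mul_of_nonneg_left (hH.energyZero_mul_le
    (x := pullV₀ L w u) (y := pullV₀ L w v) (fun _ => u.norm_coe_le_norm _)
    (fun _ => v.norm_coe_le_norm _)) (inv_nonneg.2 (H.wordProd_pos w).le)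
  refine le_trans this (le_of_eq ?_)
  ring

end IsComplete

variable (H) in
/-- The discrete energy measure of `f` at level `n`, integrated against `g`:
`∑_{|w| = n} r_w⁻¹ κ ∑_{p,q} (f(ψ_w p) - f(ψ_w q))² g(ψ_w p)`. -/
def carre (κ : ℝ) (n : ℕ) (f g : K → ℝ) : ℝ :=
  wordSum n fun w => (wordProd H.r w)⁻¹ *
    (κ * ∑ p : L.V₀, ∑ q : L.V₀, (f (L.ψw w p) - f (L.ψw w q)) ^ 2 * g (L.ψw w p))

lemma carre_add_length (m n : ℕ) (f g : K → ℝ) : H.carre κ (m + n) f g =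
    wordSum m fun v => (wordProd H.r v)⁻¹ * H.carre κ n (f ∘ L.ψw v) (g ∘ L.ψw v) := by
  simp_rw [carre, wordSum_add_length, ← wordSum_mul, wordProd_append, mul_inv, L.ψw_append,
    mul_assoc]
  rfl

lemma carre_add_right (n : ℕ) (f g g' : K → ℝ) :
    H.carre κ n f (g + g') = H.carre κ n f g + H.carre κ n f g' := by
  simp_rw [carre, ← wordSum_add, ← mul_add, ← Finset.sum_add_distrib, ← mul_add]
  rfl

lemma carre_smul_right (n : ℕ) (f g : K → ℝ) (c : ℝ) :
    H.carre κ n f (c • g) = c * H.carre κ n f g := by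
  simp_rw [carre, ← wordSum_mul, Pi.smul_apply, smul_eq_mul, mul_left_comm _ c, ← Finset.mul_sum,
    mul_left_comm _ c]

namespace IsComplete

lemma carre_mono (hH : H.IsComplete κ) (n : ℕ) (f : K → ℝ) {g g' : K → ℝ} (h : g ≤ g') :
    H.carre κ n f g ≤ H.carre κ n f g' :=
  wordSum_le fun w _ => mul_le_mul_of_nonneg_left (mul_le_mul_of_nonneg_left
    (Finset.sum_le_sum fun _ _ => Finset.sum_le_sum fun _ _ =>
      mul_le_mul_of_nonneg_left (h _) (sq_nonneg _)) hH.pos.le)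
    (inv_nonneg.2 (H.wordProd_pos w).le)

lemma carre_zero_right (n : ℕ) (f : K → ℝ) : H.carre κ n f 0 = 0 := by
  simp [carre, wordSum]

lemma carre_one_right (hH : H.IsComplete κ) (n : ℕ) (f : K → ℝ) :
    H.carre κ n f 1 = 2 * energyLevel H.D H.r n f f := by
  rw [carre, energyLevel_eq_wordSum, ← wordSum_mul]
  refine wordSum_congr fun w _ => ?_
  simp only [hH.energyZero_eq, pullV₀, Pi.one_apply, mul_one, ← pow_two]
  ring

/-- The discrete energy measures realise the defining identity of the energy measure. -/
lemma carre_eq (hH : H.IsComplete κ) (n : ℕ) (f g : K → ℝ) : H.carre κ n f g =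
    2 * energyLevel H.D H.r n f (f * g) - energyLevel H.D H.r n (f * f) g := by
  rw [carre, energyLevel_eq_wordSum, energyLevel_eq_wordSum, ← wordSum_mul, ← wordSum_sub]
  refine wordSum_congr fun w _ => ?_
  have key : ∀ x y : L.V₀ → ℝ, κ * ∑ p, ∑ q, (x p - x q) ^ 2 * y p =
      2 * energyZero H.D x (x * y) - energyZero H.D (x * x) y := by
    intro x y
    have hswap : ∑ p, ∑ q, (x p - x q) ^ 2 * y p = ∑ p, ∑ q, (x p - x q) ^ 2 * y q := by
      rw [Finset.sum_comm]
      exact Finset.sum_congr rfl fun _ _ => Finset.sum_congr rfl fun _ _ => by ring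
    have h2 : ∑ p, ∑ q, (x p - x q) ^ 2 * y p =
        ∑ p, ∑ q, ((x p - x q) * ((x * y) p - (x * y) q) -
          1 / 2 * (((x * x) p - (x * x) q) * (y p - y q))) := by
      have h3 : ∑ p, ∑ q, (x p - x q) ^ 2 * y p =
          1 / 2 * (∑ p, ∑ q, (x p - x q) ^ 2 * y p + ∑ p, ∑ q, (x p - x q) ^ 2 * y q) := by
        rw [← hswap]; ring
      rw [h3, ← Finset.sum_add_distrib, Finset.mul_sum]
      refine Finset.sum_congr rfl fun p _ => ?_
      rw [← Finset.sum_add_distrib, Finset.mul_sum]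
      refine Finset.sum_congr rfl fun q _ => ?_
      simp only [Pi.mul_apply]
      ring
    rw [h2, hH.energyZero_eq, hH.energyZero_eq]
    simp only [Finset.sum_sub_distrib, ← Finset.mul_sum]
    ring
  have := key (pullV₀ L w f) (pullV₀ L w g)
  change κ * ∑ p : L.V₀, ∑ q : L.V₀,
    (f (L.ψw w p) - f (L.ψw w q)) ^ 2 * g (L.ψw w p) = _ at this
  rw [this, show pullV₀ L w (f * g) = pullV₀ L w f * pullV₀ L w g from rfl,
    show pullV₀ L w (f * f) = pullV₀ L w f * pullV₀ L w f from rfl]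
  ring

/-- The integral of `g ∈ 𝓕` against an energy measure is the limit of its integrals against the
discrete ones. -/
lemma tendsto_carre [CompactSpace K] (hH : H.IsComplete κ) {f g : C(K, ℝ)}
    (hf : f ∈ H.domain) (hg : g ∈ H.domain) :
    Tendsto (fun n => H.carre κ n f g) atTop
      (𝓝 (2 * H.energy f (f * g) - H.energy (f * f) g)) := by
  refine Tendsto.congr (fun n => (hH.carre_eq n f g).symm) ?_
  have h1 := H.energy_tendsto hf (hH.mul_mem_domain hf hg)
  have h2 := H.energy_tendsto (hH.mul_mem_domain hf hf) hg
  rw [ContinuousMap.coe_mul] at h1 h2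
  exact (h1.const_mul 2).sub h2

end IsComplete

end RegularHarmonicStructure

/-! ### Discrete harmonic extension -/

namespace RegularHarmonicStructure

variable {K S : Type*} [TopologicalSpace K] [TopologicalSpace S] [Fintype S] {L : PCFStructure K S}
  {H : RegularHarmonicStructure L} {κ : ℝ}

lemma energyLevel_one_congr {u u' v v' : K → ℝ} (hu : ∀ i, ∀ p : L.V₀, u (L.ψ i p) = u' (L.ψ i p))
    (hv : ∀ i, ∀ p : L.V₀, v (L.ψ i p) = v' (L.ψ i p)) :
    energyLevel H.D H.r 1 u v = energyLevel H.D H.r 1 u' v' := by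
  simp only [energyLevel_one, hu, hv]

variable (H) in
/-- `v` is the discrete harmonic extension to `V₁` of the boundary values `x`: it is orthogonal,
with respect to `𝓔⁽¹⁾`, to all functions that vanish on `V₀`. -/
def IsDiscreteHarmonic (x : L.V₀ → ℝ) (v : K → ℝ) : Prop :=
  (∀ p : L.V₀, v p = x p) ∧
    ∀ v' : K → ℝ, (∀ p : L.V₀, v' p = 0) → energyLevel H.D H.r 1 v v' = 0

lemma IsDiscreteHarmonic.add {x y : L.V₀ → ℝ} {v w : K → ℝ} (hv : H.IsDiscreteHarmonic x v)
    (hw : H.IsDiscreteHarmonic y w) : H.IsDiscreteHarmonic (x + y) (v + w) :=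
  ⟨fun p => by simp [hv.1, hw.1], fun v' h' => by
    rw [energyLevel_add_left, hv.2 v' h', hw.2 v' h', add_zero]⟩

lemma IsDiscreteHarmonic.smul {x : L.V₀ → ℝ} {v : K → ℝ} (hv : H.IsDiscreteHarmonic x v) (c : ℝ) :
    H.IsDiscreteHarmonic (c • x) (c • v) :=
  ⟨fun p => by simp [hv.1], fun v' h' => by rw [energyLevel_smul_left, hv.2 v' h', mul_zero]⟩

/-- Pythagoras' identity for the orthogonal decomposition of `u` into the discrete harmonic
extension of its boundary values and a rest. -/
lemma IsDiscreteHarmonic.energyLevel_eq {x : L.V₀ → ℝ} {v : K → ℝ}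
    (hv : H.IsDiscreteHarmonic x v) {u : K → ℝ} (hu : ∀ p : L.V₀, u p = x p) :
    energyLevel H.D H.r 1 u u =
      energyLevel H.D H.r 1 v v + energyLevel H.D H.r 1 (u - v) (u - v) := by
  have h := H.energyLevel_add_self 1 v (u - v)
  rw [hv.2 (u - v) fun p => by simp [hu, hv.1], add_sub_cancel] at h
  rw [h]
  ring

lemma IsDiscreteHarmonic.energyLevel_self {x : L.V₀ → ℝ} {v : K → ℝ}
    (hv : H.IsDiscreteHarmonic x v) : energyLevel H.D H.r 1 v v = energyZero H.D x x := by
  refine le_antisymm ((H.energy_eq x).2 ?_) ((H.energy_eq x).1 ⟨v, hv.1, rfl⟩)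
  rintro _ ⟨u, hu, rfl⟩
  rw [hv.energyLevel_eq hu]
  linarith [H.energyLevel_self_nonneg 1 (u - v)]

namespace IsComplete

lemma energyZero_single (hH : H.IsComplete κ) (x y : L.V₀ → ℝ) (p : L.V₀) (hp : y p = 1)
    (hy : ∀ q, q ≠ p → y q = 0) : energyZero H.D x y = κ * ∑ q, (x p - x q) := by
  classical
  obtain rfl : y = fun q => if q = p then 1 else 0 := by
    funext q
    split_ifs with h
    · rw [h, hp]
    · exact hy q h
  rw [hH.energyZero_eq]
  have h1 : ∑ a, ∑ b, (x a - x b) * (if a = p then (1 : ℝ) else 0) = ∑ q, (x p - x q) := by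
    rw [Finset.sum_comm]
    simp
  have h2 : ∑ a, ∑ b, (x a - x b) * (if b = p then (1 : ℝ) else 0) = -∑ q, (x p - x q) := by
    simp
  simp_rw [mul_sub (x _ - x _), Finset.sum_sub_distrib (f := fun _ => _ * _)]
  rw [Finset.sum_sub_distrib, h1, h2]
  ring

open Classical in
lemma energyZero_bump (hH : H.IsComplete κ) (x : L.V₀ → ℝ) {φ : K → K} (hφ : Function.Injective φ)
    {p : L.V₀} {y : K} (hp : φ p = y) :
    energyZero H.D x (fun q => if φ q = y then 1 else 0) = κ * ∑ q, (x p - x q) :=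
  hH.energyZero_single x _ p (if_pos hp) fun _ hq =>
    if_neg fun h => hq (Subtype.ext (hφ (h.trans hp.symm)))

lemma eq_of_energyZero_eq_zero (hH : H.IsComplete κ) {x : L.V₀ → ℝ}
    (hx : energyZero H.D x x = 0) (p q : L.V₀) : x p = x q := by
  rw [hH.energyZero_eq] at hx
  have h0 : ∑ p, ∑ q, (x p - x q) * (x p - x q) = 0 :=
    (mul_eq_zero.1 hx).resolve_left (div_pos hH.pos two_pos).ne'
  have h1 := (Finset.sum_eq_zero_iff_of_nonneg fun p _ =>
    Finset.sum_nonneg fun q _ => mul_self_nonneg _).1 h0 p (Finset.mem_univ p)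
  have h2 := (Finset.sum_eq_zero_iff_of_nonneg fun q _ => mul_self_nonneg _).1 h1 q
    (Finset.mem_univ q)
  linarith [mul_self_eq_zero.1 h2]

lemma energyZero_const (hH : H.IsComplete κ) {x : L.V₀ → ℝ} (hx : ∀ p q, x p = x q)
    (y : L.V₀ → ℝ) : energyZero H.D x y = 0 := by
  rw [hH.energyZero_eq]
  simp [fun p q => sub_eq_zero.2 (hx p q)]

variable [CompactSpace K] [T2Space K] [PreconnectedSpace K] [Nonempty L.V₀]

lemma eq_zero_of_energyLevel_one (hH : H.IsComplete κ) {u : K → ℝ} (hu : ∀ p : L.V₀, u p = 0)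
    (h : energyLevel H.D H.r 1 u u = 0) (i : S) (p : L.V₀) : u (L.ψ i p) = 0 := by
  have hconst : ∀ i, ∀ p q : L.V₀, u (L.ψ i p) = u (L.ψ i q) := by
    intro i
    rw [energyLevel_one] at h
    have := (Finset.sum_eq_zero_iff_of_nonneg fun i _ =>
      mul_nonneg (inv_nonneg.2 (H.r_pos i).le) (H.energyZero_self_nonneg _)).1 h i
      (Finset.mem_univ i)
    exact hH.eq_of_energyZero_eq_zero
      ((mul_eq_zero.1 this).resolve_left (inv_ne_zero (H.r_pos i).ne'))
  refine L.cells_connected {i | ∀ p : L.V₀, u (L.ψ i p) = 0} ?_ ?_ i p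
  · obtain ⟨p⟩ : Nonempty L.V₀ := inferInstance
    obtain ⟨j, hj⟩ := hH.fixed p p.2
    exact ⟨j, fun q => by rw [hconst j q p, hj, hu]⟩
  · intro i hi j hj x y hxy q
    have hx := L.mem_V₀_of_ψ_eq hj.symm hxy
    have hy := L.mem_V₀_of_ψ_eq hj hxy.symm
    have h1 : u (L.ψ i x) = 0 := hi ⟨x, hx⟩
    rw [hconst j q ⟨y, hy⟩]
    exact hxy ▸ h1

lemma exists_isDiscreteHarmonic (hH : H.IsComplete κ) (x : L.V₀ → ℝ) :
    ∃ v, H.IsDiscreteHarmonic x v := by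
  classical
  let V₁ : Set K := Set.range fun ip : S × L.V₀ => L.ψ ip.1 ip.2
  let N : Type _ := {y : K // y ∈ V₁ ∧ y ∉ L.V₀}
  have : Finite N := ((Set.finite_range fun ip : S × L.V₀ => L.ψ ip.1 ip.2).subset
    (fun y hy => hy.1 : {y : K | y ∈ V₁ ∧ y ∉ L.V₀} ⊆ _)).to_subtype
  let e : (N → ℝ) →ₗ[ℝ] (K → ℝ) := Function.ExtendByZero.linearMap ℝ Subtype.val
  have he : ∀ u (n : N), e u n.1 = u n := fun u n => Subtype.val_injective.extend_apply u 0 n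
  have he0 : ∀ u (p : L.V₀), e u p = 0 := fun u p =>
    Function.extend_apply' _ _ _ fun ⟨n, hn⟩ => n.2.2 (hn ▸ p.2)
  let T : (N → ℝ) →ₗ[ℝ] Module.Dual ℝ (N → ℝ) :=
    LinearMap.mk₂ ℝ (fun u u' => energyLevel H.D H.r 1 (e u) (e u'))
      (fun u u' w => by rw [map_add, energyLevel_add_left])
      (fun c u w => by rw [map_smul, energyLevel_smul_left]; rfl)
      (fun u w w' => by rw [map_add, energyLevel_add_right])
      (fun c u w => by rw [map_smul, energyLevel_smul_right]; rfl)
  have hinj : Function.Injective T := by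
    refine (injective_iff_map_eq_zero T).2 fun u hu => ?_
    have h0 : energyLevel H.D H.r 1 (e u) (e u) = 0 := LinearMap.congr_fun hu u
    funext n
    obtain ⟨⟨i, p⟩, hn⟩ := n.2.1
    have := hH.eq_zero_of_energyLevel_one (he0 u) h0 i p
    simp only at hn
    rw [hn, he] at this
    exact this
  have hsurj : Function.Surjective T :=
    (LinearMap.injective_iff_surjective_of_finrank_eq_finrank
      Subspace.dual_finrank_eq.symm).1 hinj
  let v₀ : K → ℝ := Function.extend Subtype.val x 0
  have hv₀ : ∀ p : L.V₀, v₀ p = x p := fun p => Subtype.val_injective.extend_apply x 0 p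
  let ℓ : Module.Dual ℝ (N → ℝ) :=
    { toFun := fun u' => -energyLevel H.D H.r 1 v₀ (e u')
      map_add' := fun a b => by rw [map_add, energyLevel_add_right]; ring
      map_smul' := fun c a => by
        rw [map_smul, energyLevel_smul_right, RingHom.id_apply, smul_eq_mul]; ring }
  obtain ⟨u, hu⟩ := hsurj ℓ
  refine ⟨v₀ + e u, fun p => by simp [hv₀, he0], fun v' hv' => ?_⟩
  have h1 : energyLevel H.D H.r 1 (e u) (e fun n => v' n.1) =
    -energyLevel H.D H.r 1 v₀ (e fun n => v' n.1) := LinearMap.congr_fun hu _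
  have h2 : energyLevel H.D H.r 1 (v₀ + e u) v' =
      energyLevel H.D H.r 1 (v₀ + e u) (e fun n => v' n.1) := by
    refine energyLevel_one_congr (fun _ _ => rfl) fun i p => ?_
    by_cases hp : L.ψ i p ∈ L.V₀
    · rw [hv' ⟨_, hp⟩]
      exact (he0 _ ⟨_, hp⟩).symm
    · exact (he (fun n => v' n.1) ⟨L.ψ i p, ⟨(i, p), rfl⟩, hp⟩).symm
  rw [h2, energyLevel_add_left, h1, add_neg_cancel]

/-- A function whose level-one energy does not exceed the energy of its boundary values is discrete
harmonic. -/
lemma eq_of_energyLevel_one_le (hH : H.IsComplete κ) {x : L.V₀ → ℝ} {v u : K → ℝ}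
    (hv : H.IsDiscreteHarmonic x v) (hu : ∀ p : L.V₀, u p = x p)
    (h : energyLevel H.D H.r 1 u u ≤ energyZero H.D x x) (i : S) (p : L.V₀) :
    u (L.ψ i p) = v (L.ψ i p) := by
  rw [hv.energyLevel_eq hu, hv.energyLevel_self] at h
  have h0 : energyLevel H.D H.r 1 (u - v) (u - v) = 0 :=
    le_antisymm (by linarith) (H.energyLevel_self_nonneg _ _)
  exact sub_eq_zero.1
    (hH.eq_zero_of_energyLevel_one (u := u - v) (fun p => by simp [hu, hv.1]) h0 i p)

lemma isDiscreteHarmonic_unique (hH : H.IsComplete κ) {x : L.V₀ → ℝ} {v u : K → ℝ}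
    (hv : H.IsDiscreteHarmonic x v) (hu : H.IsDiscreteHarmonic x u) (i : S) (p : L.V₀) :
    u (L.ψ i p) = v (L.ψ i p) :=
  hH.eq_of_energyLevel_one_le hv hu.1 hu.energyLevel_self.le i p

/-- Gauss–Green formula on `V₁`. -/
lemma energyLevel_one_eq_energyZero (hH : H.IsComplete κ) {x : L.V₀ → ℝ} {v : K → ℝ}
    (hv : H.IsDiscreteHarmonic x v) (u : K → ℝ) :
    energyLevel H.D H.r 1 v u = energyZero H.D x fun p => u p := by
  obtain ⟨w, hw⟩ := hH.exists_isDiscreteHarmonic fun p : L.V₀ => u p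
  have h1 : energyLevel H.D H.r 1 v u = energyLevel H.D H.r 1 v w := by
    have := hv.2 (u - w) fun p => by simp [hw.1]
    have h2 := energyLevel_add_right H.D H.r 1 v w (u - w)
    rw [add_sub_cancel, this, add_zero] at h2
    exact h2
  have h3 := (hv.add hw).energyLevel_self
  rw [H.energyLevel_add_self, hv.energyLevel_self, hw.energyLevel_self, energyZero_add_left,
    energyZero_add_right, energyZero_add_right,
    H.energyZero_comm (fun p => u p) x] at h3
  rw [h1]
  linarith

/-- The minimum principle on `V₁`: replacing `v` by `|v|` does not increase the energy. -/
lemma isDiscreteHarmonic_nonneg (hH : H.IsComplete κ) {x : L.V₀ → ℝ} {v : K → ℝ}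
    (hv : H.IsDiscreteHarmonic x v) (hx : ∀ p, 0 ≤ x p) (i : S) (p : L.V₀) :
    0 ≤ v (L.ψ i p) := by
  have hle : energyLevel H.D H.r 1 (fun y => |v y|) (fun y => |v y|) ≤ energyZero H.D x x := by
    rw [← hv.energyLevel_self, energyLevel_one, energyLevel_one]
    refine Finset.sum_le_sum fun i _ =>
      mul_le_mul_of_nonneg_left ?_ (inv_nonneg.2 (H.r_pos i).le)
    rw [hH.energyZero_eq, hH.energyZero_eq]
    refine mul_le_mul_of_nonneg_left ?_ (div_pos hH.pos two_pos).le
    refine Finset.sum_le_sum fun p _ => Finset.sum_le_sum fun q _ => ?_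
    rw [← abs_mul_abs_self (|v (L.ψ i p)| - |v (L.ψ i q)|),
      ← abs_mul_abs_self (v (L.ψ i p) - v (L.ψ i q))]
    exact mul_self_le_mul_self (abs_nonneg _) (abs_abs_sub_abs_le _ _)
  have := hH.eq_of_energyLevel_one_le hv (u := fun y => |v y|)
    (fun p => by rw [hv.1, abs_of_nonneg (hx p)]) hle i p
  rw [← this]
  exact abs_nonneg _

/-- The strong minimum principle on `V₁`: a zero at an interior vertex spreads to all cells that
contain the vertex, hence, by connectedness and because boundary vertices belong to one cell only,
to all of `V₁`. -/
lemma isDiscreteHarmonic_pos (hH : H.IsComplete κ) {x : L.V₀ → ℝ} {v : K → ℝ}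
    (hv : H.IsDiscreteHarmonic x v) (hx : ∀ p, 0 ≤ x p) {s : L.V₀} (hs : 0 < x s) {i : S}
    {p : L.V₀} (hp : L.ψ i p ∉ L.V₀) : 0 < v (L.ψ i p) := by
  classical
  by_contra hcon
  have hnn := hH.isDiscreteHarmonic_nonneg hv hx
  have h0 : v (L.ψ i p) = 0 := le_antisymm (not_lt.1 hcon) (hnn i p)
  -- a zero at an interior vertex spreads over every cell that contains it
  have spread : ∀ i, ∀ p : L.V₀, L.ψ i p ∉ L.V₀ → v (L.ψ i p) = 0 → ∀ q : L.V₀,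
      v (L.ψ i q) = 0 := by
    intro i p hp h0 q
    have hE := hv.2 (fun z => if z = L.ψ i p then 1 else 0) fun q =>
      if_neg fun h : (q : K) = L.ψ i p => hp (h ▸ q.2)
    rw [energyLevel_one] at hE
    have hterm : ∀ k, (H.r k)⁻¹ * energyZero H.D (fun q => v (L.ψ k q))
        (fun q => if L.ψ k q = L.ψ i p then 1 else 0) ≤ 0 := by
      intro k
      refine mul_nonpos_of_nonneg_of_nonpos (inv_nonneg.2 (H.r_pos k).le) ?_
      by_cases hk : ∃ q : L.V₀, L.ψ k q = L.ψ i p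
      · obtain ⟨q, hq⟩ := hk
        rw [hH.energyZero_bump _ (L.ψ_injective k) hq]
        refine mul_nonpos_of_nonneg_of_nonpos hH.pos.le (Finset.sum_nonpos fun q' _ => ?_)
        rw [hq, h0]
        linarith [hnn k q']
      · rw [show (fun q : L.V₀ => if L.ψ k q = L.ψ i p then (1 : ℝ) else 0) = 0 from
          funext fun q => if_neg fun h => hk ⟨q, h⟩]
        simp [energyZero]
    have hi := (Finset.sum_eq_zero_iff_of_nonpos fun k _ => hterm k).1 hE i (Finset.mem_univ i)
    have hi' := (mul_eq_zero.1 hi).resolve_left (inv_ne_zero (H.r_pos i).ne')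
    rw [hH.energyZero_bump _ (L.ψ_injective i) rfl] at hi'
    have hsum := (mul_eq_zero.1 hi').resolve_left hH.pos.ne'
    have := (Finset.sum_eq_zero_iff_of_nonpos fun q' _ => by
      rw [h0]; linarith [hnn i q']).1 hsum q (Finset.mem_univ q)
    linarith
  have hall := L.cells_connected {i | ∀ q : L.V₀, v (L.ψ i q) = 0} ⟨i, spread i p hp h0⟩ (by
    intro k hk l hl y z hyz
    have hy := L.mem_V₀_of_ψ_eq hl.symm hyz
    have hz := L.mem_V₀_of_ψ_eq hl hyz.symm
    refine spread l ⟨z, hz⟩ (fun hmem => ?_) ?_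
    · obtain ⟨j, hj⟩ := hH.fixed _ hmem
      exact hl ((L.eq_of_ψ_eq_fixed hj rfl).trans (L.eq_of_ψ_eq_fixed hj hyz).symm)
    · exact hyz ▸ hk ⟨y, hy⟩)
  obtain ⟨j, hj⟩ := hH.fixed s s.2
  have := hall j s
  rw [hj, hv.1] at this
  exact hs.ne' this

end IsComplete

/-! ### Transition maps -/

open Classical in
variable (H) in
/-- The values at `ψ_i(p)`, `p ∈ V₀`, of the discrete harmonic extension of `x`. It agrees with
`H.A i x`, which is defined through the continuous harmonic extension. -/
def stepFun (i : S) (x : L.V₀ → ℝ) : L.V₀ → ℝ := fun p =>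
  if hx : ∃ v, H.IsDiscreteHarmonic x v then hx.choose (L.ψ i p) else 0

namespace IsComplete

variable [CompactSpace K] [T2Space K] [PreconnectedSpace K] [Nonempty L.V₀]

lemma stepFun_eq (hH : H.IsComplete κ) {x : L.V₀ → ℝ} {v : K → ℝ}
    (hv : H.IsDiscreteHarmonic x v) (i : S) (p : L.V₀) : H.stepFun i x p = v (L.ψ i p) := by
  have hx : ∃ v, H.IsDiscreteHarmonic x v := ⟨v, hv⟩
  rw [stepFun, dif_pos hx]
  exact hH.isDiscreteHarmonic_unique hv hx.choose_spec i p

/-- The linear map `x ↦ H.stepFun i x`. -/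
def step (hH : H.IsComplete κ) (i : S) : (L.V₀ → ℝ) →ₗ[ℝ] (L.V₀ → ℝ) where
  toFun := H.stepFun i
  map_add' x y := by
    obtain ⟨v, hv⟩ := hH.exists_isDiscreteHarmonic x
    obtain ⟨w, hw⟩ := hH.exists_isDiscreteHarmonic y
    funext p
    rw [Pi.add_apply, hH.stepFun_eq hv, hH.stepFun_eq hw, hH.stepFun_eq (hv.add hw), Pi.add_apply]
  map_smul' c x := by
    obtain ⟨v, hv⟩ := hH.exists_isDiscreteHarmonic x
    funext p
    rw [RingHom.id_apply, Pi.smul_apply, hH.stepFun_eq hv, hH.stepFun_eq (hv.smul c),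
      Pi.smul_apply]

lemma step_eq (hH : H.IsComplete κ) {x : L.V₀ → ℝ} {v : K → ℝ}
    (hv : H.IsDiscreteHarmonic x v) (i : S) (p : L.V₀) : hH.step i x p = v (L.ψ i p) :=
  hH.stepFun_eq hv i p

lemma step_eq_of_energyLevel_one_le (hH : H.IsComplete κ) {u : K → ℝ}
    (h : energyLevel H.D H.r 1 u u ≤ energyZero H.D (fun p => u p) (fun p => u p)) (i : S)
    (p : L.V₀) : hH.step i (fun p => u p) p = u (L.ψ i p) := by
  obtain ⟨v, hv⟩ := hH.exists_isDiscreteHarmonic fun p : L.V₀ => u p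
  rw [hH.step_eq hv, hH.eq_of_energyLevel_one_le hv (fun _ => rfl) h]

lemma sum_energyZero_step (hH : H.IsComplete κ) (x : L.V₀ → ℝ) :
    ∑ i, (H.r i)⁻¹ * energyZero H.D (hH.step i x) (hH.step i x) = energyZero H.D x x := by
  obtain ⟨v, hv⟩ := hH.exists_isDiscreteHarmonic x
  rw [← hv.energyLevel_self, energyLevel_one]
  simp only [← hH.step_eq hv]

lemma step_fixed (hH : H.IsComplete κ) (x : L.V₀ → ℝ) {j : S} {p : L.V₀} (hp : L.ψ j p = p) :
    hH.step j x p = x p := by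
  obtain ⟨v, hv⟩ := hH.exists_isDiscreteHarmonic x
  rw [hH.step_eq hv, hp, hv.1]

lemma step_compat (hH : H.IsComplete κ) (x : L.V₀ → ℝ) {i j : S} {p q : L.V₀}
    (h : L.ψ i p = L.ψ j q) : hH.step i x p = hH.step j x q := by
  obtain ⟨v, hv⟩ := hH.exists_isDiscreteHarmonic x
  rw [hH.step_eq hv, hH.step_eq hv, h]

lemma step_const (hH : H.IsComplete κ) (i : S) (c : ℝ) :
    hH.step i (fun _ => c) = fun _ => c := by
  have : H.IsDiscreteHarmonic (fun _ => c) (fun _ => c) := ⟨fun _ => rfl, fun v' _ => by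
    rw [energyLevel_one]
    exact Finset.sum_eq_zero fun i _ => by rw [hH.energyZero_const fun _ _ => rfl, mul_zero]⟩
  funext p
  exact hH.step_eq this i p

lemma step_nonneg (hH : H.IsComplete κ) {x : L.V₀ → ℝ} (hx : ∀ p, 0 ≤ x p) (i : S) (p : L.V₀) :
    0 ≤ hH.step i x p := by
  obtain ⟨v, hv⟩ := hH.exists_isDiscreteHarmonic x
  rw [hH.step_eq hv]
  exact hH.isDiscreteHarmonic_nonneg hv hx i p

lemma step_mono (hH : H.IsComplete κ) {x y : L.V₀ → ℝ} (hxy : ∀ p, x p ≤ y p) (i : S)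
    (p : L.V₀) : hH.step i x p ≤ hH.step i y p := by
  have := hH.step_nonneg (x := y - x) (fun p => sub_nonneg.2 (hxy p)) i p
  rw [map_sub] at this
  exact sub_nonneg.1 this

lemma step_pos (hH : H.IsComplete κ) {x : L.V₀ → ℝ} (hx : ∀ p, 0 ≤ x p) {s : L.V₀}
    (hs : 0 < x s) {j : S} {p q : L.V₀} (hp : L.ψ j p = p) (hq : q ≠ p) :
    0 < hH.step j x q := by
  obtain ⟨v, hv⟩ := hH.exists_isDiscreteHarmonic x
  rw [hH.step_eq hv]
  refine hH.isDiscreteHarmonic_pos hv hx hs fun hmem => hq ?_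
  obtain ⟨k, hk⟩ := hH.fixed _ hmem
  obtain rfl := L.eq_of_ψ_eq_fixed hk rfl
  exact Subtype.ext (L.fixed_unique (L.ψ_injective _ hk) hp)

/-- At the fixed point `p` of `ψ_j`, the normal derivative of a harmonic function restricted to the
cell `j` is `r_j` times that of the function: `u_j` is an eigenvector of the transpose of `A_j`. -/
lemma sum_step_sub (hH : H.IsComplete κ) (x : L.V₀ → ℝ) {j : S} {p : L.V₀} (hp : L.ψ j p = p) :
    ∑ q, (hH.step j x p - hH.step j x q) = H.r j * ∑ q, (x p - x q) := by
  classical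
  obtain ⟨v, hv⟩ := hH.exists_isDiscreteHarmonic x
  have h := (hH.energyLevel_one_eq_energyZero hv fun z => if z = p then 1 else 0).trans
    (hH.energyZero_bump x (φ := id) Function.injective_id (p := p) rfl)
  rw [energyLevel_one, Finset.sum_eq_single j, hH.energyZero_bump _ (L.ψ_injective j) hp] at h
  · simp only [← hH.step_eq hv] at h
    have hr := (H.r_pos j).ne'
    have hκ := hH.pos.ne'
    field_simp at h
    linarith
  · intro i _ hi
    rw [show (fun q : L.V₀ => if L.ψ i q = p then (1 : ℝ) else 0) = 0 from
      funext fun q => if_neg fun h => hi (L.eq_of_ψ_eq_fixed hp h)]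
    simp [energyZero]
  · simp

end IsComplete

end RegularHarmonicStructure

/-! ### Harmonic functions on `K` -/

namespace SelfSimilarStructure

lemma prefixWord_succ {S : Type*} (n : ℕ) (ω : ℕ → S) :
    prefixWord (n + 1) ω = prefixWord n ω ++ [ω n] := by
  induction n generalizing ω with
  | zero => rfl
  | succ n ih =>
    rw [prefixWord, ih]
    rfl

lemma prefixWord_eq_ofFn {S : Type*} (n : ℕ) (ω : ℕ → S) :
    prefixWord n ω = List.ofFn fun k : Fin n => ω k := by
  induction n generalizing ω with
  | zero => rfl
  | succ n ih => rw [prefixWord, ih, List.ofFn_succ]; rfl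

lemma continuous_comp_prefixWord {S X : Type*} [TopologicalSpace S] [DiscreteTopology S]
    [TopologicalSpace X] (n : ℕ) (F : List S → X) : Continuous fun ω => F (prefixWord n ω) := by
  simp_rw [prefixWord_eq_ofFn]
  exact (continuous_of_discreteTopology (f := fun v : Fin n → S => F (List.ofFn v))).comp
    (continuous_pi fun k => continuous_apply (k : ℕ))

variable {K S : Type*} [TopologicalSpace K] [TopologicalSpace S] (L : SelfSimilarStructure K S)

/-- A function on the code space that is constant on the fibres of `π` descends to `K`. -/
lemma exists_continuousMap_of_code [CompactSpace K] [T2Space K] [Finite S] {F : (ℕ → S) → ℝ}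
    (hF : Continuous F) (hfib : ∀ ω τ, L.π ω = L.π τ → F ω = F τ) :
    ∃ g : C(K, ℝ), ∀ ω, g (L.π ω) = F ω := by
  have hq : IsQuotientMap (⟨L.π, L.π_continuous⟩ : C(ℕ → S, K)) := L.isQuotientMap_π
  exact ⟨hq.lift ⟨F, hF⟩ fun ω τ h => hfib ω τ h,
    fun ω => DFunLike.congr_fun (hq.lift_comp ⟨F, hF⟩ fun ω τ h => hfib ω τ h) ω⟩

end SelfSimilarStructure

namespace RegularHarmonicStructure

open SelfSimilarStructure

variable {K S : Type*} [TopologicalSpace K] [TopologicalSpace S] [Fintype S] {L : PCFStructure K S}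
  {H : RegularHarmonicStructure L} {κ : ℝ}

namespace IsComplete

lemma abs_sub_le (hH : H.IsComplete κ) (x : L.V₀ → ℝ) (p q : L.V₀) :
    |x p - x q| ≤ √(2 / κ * energyZero H.D x x) := by
  refine Real.abs_le_sqrt ?_
  have h1 : (x p - x q) ^ 2 ≤ ∑ p, ∑ q, (x p - x q) * (x p - x q) := by
    rw [sq]
    refine le_trans (Finset.single_le_sum (f := fun q => (x p - x q) * (x p - x q))
      (fun q _ => mul_self_nonneg _) (Finset.mem_univ q)) ?_
    exact Finset.single_le_sum (f := fun p => ∑ q, (x p - x q) * (x p - x q))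
      (fun p _ => Finset.sum_nonneg fun q _ => mul_self_nonneg _) (Finset.mem_univ p)
  have hκ := hH.pos.ne'
  rw [hH.energyZero_eq]
  field_simp
  simpa only [← sq] using h1

variable [CompactSpace K] [T2Space K] [PreconnectedSpace K] [Nonempty L.V₀]

/-- The composition of the transition maps along a word; it agrees with `H.Aw w`. -/
def stepWord (hH : H.IsComplete κ) (w : List S) (x : L.V₀ → ℝ) : L.V₀ → ℝ :=
  w.foldl (fun y i => hH.step i y) x

@[simp] lemma stepWord_nil (hH : H.IsComplete κ) (x : L.V₀ → ℝ) : hH.stepWord [] x = x := rfl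

@[simp] lemma stepWord_cons (hH : H.IsComplete κ) (i : S) (w : List S) (x : L.V₀ → ℝ) :
    hH.stepWord (i :: w) x = hH.stepWord w (hH.step i x) := rfl

lemma stepWord_append (hH : H.IsComplete κ) (v w : List S) (x : L.V₀ → ℝ) :
    hH.stepWord (v ++ w) x = hH.stepWord w (hH.stepWord v x) := List.foldl_append

lemma step_mem_Icc (hH : H.IsComplete κ) {x : L.V₀ → ℝ} {a b : ℝ} (hx : ∀ p, x p ∈ Set.Icc a b)
    (i : S) (p : L.V₀) : hH.step i x p ∈ Set.Icc a b := by
  have h1 := hH.step_mono (x := fun _ => a) (fun p => (hx p).1) i p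
  have h2 := hH.step_mono (y := fun _ => b) (fun p => (hx p).2) i p
  rw [hH.step_const] at h1 h2
  exact ⟨h1, h2⟩

lemma stepWord_mem_Icc (hH : H.IsComplete κ) {x : L.V₀ → ℝ} {a b : ℝ}
    (hx : ∀ p, x p ∈ Set.Icc a b) (w : List S) (p : L.V₀) : hH.stepWord w x p ∈ Set.Icc a b := by
  induction w generalizing x with
  | nil => exact hx p
  | cons i w ih => exact ih (hH.step_mem_Icc hx i)

lemma stepWord_replicate_fixed (hH : H.IsComplete κ) (x : L.V₀ → ℝ) {j : S} {p : L.V₀}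
    (hp : L.ψ j p = p) (n : ℕ) : hH.stepWord (List.replicate n j) x p = x p := by
  induction n generalizing x with
  | zero => rfl
  | succ n ih => rw [List.replicate_succ, stepWord_cons, ih, hH.step_fixed x hp]

lemma energyZero_stepWord_le (hH : H.IsComplete κ) (w : List S) (x : L.V₀ → ℝ) :
    energyZero H.D (hH.stepWord w x) (hH.stepWord w x) ≤ wordProd H.r w * energyZero H.D x x := by
  induction w generalizing x with
  | nil => simp
  | cons i w ih =>
    have h1 : (H.r i)⁻¹ * energyZero H.D (hH.step i x) (hH.step i x) ≤ energyZero H.D x x := by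
      rw [← hH.sum_energyZero_step x]
      exact Finset.single_le_sum (f := fun i => (H.r i)⁻¹ *
        energyZero H.D (hH.step i x) (hH.step i x)) (fun i _ => mul_nonneg
          (inv_nonneg.2 (H.r_pos i).le) (H.energyZero_self_nonneg _)) (Finset.mem_univ i)
    rw [inv_mul_le_iff₀ (H.r_pos i)] at h1
    refine (ih _).trans ?_
    rw [wordProd_cons, mul_comm (H.r i), mul_assoc]
    exact mul_le_mul_of_nonneg_left h1 (H.wordProd_pos w).le

end IsComplete

variable (H) in
lemma exists_wordProd_le [Nonempty S] :
    ∃ ρ : ℝ, 0 ≤ ρ ∧ ρ < 1 ∧ ∀ w : List S, wordProd H.r w ≤ ρ ^ w.length := by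
  obtain ⟨i₀, hi₀⟩ := Finite.exists_max H.r
  refine ⟨H.r i₀, (H.r_pos _).le, H.r_lt_one _, fun w => ?_⟩
  induction w with
  | nil => simp
  | cons i w ih =>
    rw [wordProd_cons, List.length_cons, pow_succ, mul_comm]
    exact mul_le_mul ih (hi₀ i) (H.r_pos i).le (pow_nonneg (H.r_pos _).le _)

namespace IsComplete

variable [CompactSpace K] [T2Space K] [PreconnectedSpace K] [Nonempty L.V₀]

/-- Oscillations of harmonic functions decay geometrically with the level. -/
lemma exists_osc_le (hH : H.IsComplete κ) (x : L.V₀ → ℝ) : ∃ C θ : ℝ, 0 ≤ θ ∧ θ < 1 ∧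
    ∀ w p q, |hH.stepWord w x p - hH.stepWord w x q| ≤ C * θ ^ w.length := by
  have hS : Nonempty S := by
    obtain ⟨p⟩ : Nonempty L.V₀ := inferInstance
    exact ⟨(hH.fixed p p.2).choose⟩
  obtain ⟨ρ, h0, h1, hρ⟩ := H.exists_wordProd_le
  refine ⟨√(2 / κ * energyZero H.D x x), √ρ, Real.sqrt_nonneg _, ?_, fun w p q => ?_⟩
  · rw [Real.sqrt_lt' one_pos]; simpa using h1
  · refine (hH.abs_sub_le _ p q).trans ?_
    refine Real.sqrt_le_iff.2 ⟨by positivity, ?_⟩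
    have hE := mul_nonneg (div_pos two_pos hH.pos).le (H.energyZero_self_nonneg x)
    rw [mul_pow, Real.sq_sqrt hE, ← pow_mul, mul_comm w.length, pow_mul, Real.sq_sqrt h0, mul_assoc,
      mul_comm (energyZero H.D x x)]
    refine mul_le_mul_of_nonneg_left ((hH.energyZero_stepWord_le w x).trans ?_)
      (div_pos two_pos hH.pos).le
    exact mul_le_mul_of_nonneg_right (hρ w) (H.energyZero_self_nonneg x)

/-- The value, at the point with code `ω`, of the harmonic function with boundary values `x`. -/
def codeValue (hH : H.IsComplete κ) (x : L.V₀ → ℝ) (ω : ℕ → S) : ℝ :=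
  limUnder atTop fun n => hH.stepWord (prefixWord n ω) x (Classical.arbitrary _)

lemma dist_stepWord_prefixWord_succ (hH : H.IsComplete κ) {x : L.V₀ → ℝ} {C θ : ℝ}
    (hosc : ∀ w p q, |hH.stepWord w x p - hH.stepWord w x q| ≤ C * θ ^ w.length) (ω : ℕ → S)
    (p : L.V₀) (n : ℕ) : dist (hH.stepWord (prefixWord n ω) x p)
      (hH.stepWord (prefixWord (n + 1) ω) x p) ≤ C * θ ^ n := by
  have hb : ∀ q, hH.stepWord (prefixWord n ω) x q ∈
      Set.Icc (hH.stepWord (prefixWord n ω) x p - C * θ ^ n)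
        (hH.stepWord (prefixWord n ω) x p + C * θ ^ n) := by
    intro q
    have := abs_le.1 (hosc (prefixWord n ω) q p)
    rw [length_prefixWord] at this
    exact ⟨by linarith, by linarith⟩
  have := hH.step_mem_Icc hb (ω n) p
  rw [prefixWord_succ, stepWord_append, stepWord_cons, stepWord_nil, Real.dist_eq, abs_sub_comm,
    abs_le]
  exact ⟨by linarith [this.1], by linarith [this.2]⟩

lemma tendsto_codeValue (hH : H.IsComplete κ) (x : L.V₀ → ℝ) (ω : ℕ → S) (p : L.V₀) :
    Tendsto (fun n => hH.stepWord (prefixWord n ω) x p) atTop (𝓝 (hH.codeValue x ω)) := by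
  obtain ⟨C, θ, h0, h1, hosc⟩ := hH.exists_osc_le x
  have hlim : Tendsto (fun n => hH.stepWord (prefixWord n ω) x (Classical.arbitrary _)) atTop
      (𝓝 (hH.codeValue x ω)) :=
    tendsto_nhds_limUnder (cauchySeq_tendsto_of_complete (cauchySeq_of_le_geometric θ C h1
      (hH.dist_stepWord_prefixWord_succ hosc ω _)))
  refine hlim.congr_dist (squeeze_zero (fun _ => dist_nonneg) (g := fun n => C * θ ^ n)
    (fun n => ?_) ?_)
  · simpa [Real.dist_eq] using hosc (prefixWord n ω) (Classical.arbitrary _) p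
  · simpa using (tendsto_pow_atTop_nhds_zero_of_lt_one h0 h1).const_mul C

lemma continuous_codeValue [DiscreteTopology S] (hH : H.IsComplete κ) (x : L.V₀ → ℝ) :
    Continuous (hH.codeValue x) := by
  obtain ⟨C, θ, h0, h1, hosc⟩ := hH.exists_osc_le x
  obtain ⟨p⟩ : Nonempty L.V₀ := inferInstance
  have hunif : TendstoUniformly (fun n ω => hH.stepWord (prefixWord n ω) x p) (hH.codeValue x)
      atTop := by
    rw [Metric.tendstoUniformly_iff]
    intro ε hε
    have : Tendsto (fun n : ℕ => C * θ ^ n / (1 - θ)) atTop (𝓝 0) := by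
      simpa using ((tendsto_pow_atTop_nhds_zero_of_lt_one h0 h1).const_mul C).div_const (1 - θ)
    filter_upwards [this.eventually_lt_const hε] with n hn ω
    rw [dist_comm]
    exact (dist_le_of_le_geometric_of_tendsto θ C h1 (hH.dist_stepWord_prefixWord_succ hosc ω p)
      (hH.tendsto_codeValue x ω p) n).trans_lt hn
  exact hunif.continuous (Frequently.of_forall fun n =>
    continuous_comp_prefixWord n fun w => hH.stepWord w x p)

lemma codeValue_prepend (hH : H.IsComplete κ) (x : L.V₀ → ℝ) (i : S) (ω : ℕ → S) :
    hH.codeValue x (prepend i ω) = hH.codeValue (hH.step i x) ω := by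
  refine tendsto_nhds_unique ?_ (hH.tendsto_codeValue (hH.step i x) ω (Classical.arbitrary _))
  exact (tendsto_add_atTop_iff_nat 1).2
    (hH.tendsto_codeValue x (prepend i ω) (Classical.arbitrary _))

lemma codeValue_boundary (hH : H.IsComplete κ) (x : L.V₀ → ℝ) {ω : ℕ → S} {p : L.V₀}
    (hω : L.π ω = p) : hH.codeValue x ω = x p := by
  obtain ⟨j, hj⟩ := hH.fixed p p.2
  obtain rfl := L.code_unique hj hω
  refine tendsto_nhds_unique (hH.tendsto_codeValue x _ p) ?_
  simp_rw [prefixWord_const, hH.stepWord_replicate_fixed x hj]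
  exact tendsto_const_nhds

lemma codeValue_eq_of_π_eq (hH : H.IsComplete κ) (x : L.V₀ → ℝ) (ω τ : ℕ → S)
    (h : L.π ω = L.π τ) : hH.codeValue x ω = hH.codeValue x τ := by
  have key : ∀ k, ∀ (x : L.V₀ → ℝ) (ω τ : ℕ → S), L.π ω = L.π τ → ω k ≠ τ k →
      hH.codeValue x ω = hH.codeValue x τ := by
    intro k
    induction k with
    | zero =>
      intro x ω τ h hk
      rw [← prepend_head_tail ω, ← prepend_head_tail τ, ← L.ψ_π, ← L.ψ_π] at h
      have h1 := L.mem_V₀_of_ψ_eq hk h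
      have h2 := L.mem_V₀_of_ψ_eq hk.symm h.symm
      rw [← prepend_head_tail ω, ← prepend_head_tail τ, codeValue_prepend, codeValue_prepend,
        hH.codeValue_boundary _ (p := ⟨_, h1⟩) rfl, hH.codeValue_boundary _ (p := ⟨_, h2⟩) rfl]
      exact hH.step_compat x h
    | succ k ih =>
      intro x ω τ h hk
      by_cases h0 : ω 0 = τ 0
      · rw [← prepend_head_tail ω, ← prepend_head_tail τ, ← L.ψ_π, ← L.ψ_π, h0] at h
        rw [← prepend_head_tail ω, ← prepend_head_tail τ, codeValue_prepend, codeValue_prepend, h0]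
        exact ih _ _ _ (L.ψ_injective _ h) hk
      · rw [← prepend_head_tail ω, ← prepend_head_tail τ, ← L.ψ_π, ← L.ψ_π] at h
        have h1 := L.mem_V₀_of_ψ_eq h0 h
        have h2 := L.mem_V₀_of_ψ_eq (Ne.symm h0) h.symm
        rw [← prepend_head_tail ω, ← prepend_head_tail τ, codeValue_prepend, codeValue_prepend,
          hH.codeValue_boundary _ (p := ⟨_, h1⟩) rfl, hH.codeValue_boundary _ (p := ⟨_, h2⟩) rfl]
        exact hH.step_compat x h
  by_cases hne : ω = τ
  · rw [hne]
  · obtain ⟨k, hk⟩ := Function.ne_iff.1 hne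
    exact key k x ω τ h hk

/-- A function whose energies at all levels do not exceed the energy of its boundary values has the
values of the harmonic function on all `V_m`. -/
lemma stepWord_eq_of_energyLevel_le (hH : H.IsComplete κ) (w : List S) {u : K → ℝ}
    (hu : ∀ n, energyLevel H.D H.r n u u ≤ energyZero H.D (fun p => u p) (fun p => u p))
    (p : L.V₀) : u (L.ψw w p) = hH.stepWord w (fun p => u p) p := by
  induction w generalizing u with
  | nil => rfl
  | cons i w ih =>
    have h1 : ∀ k, hH.step k (fun p => u p) = fun p : L.V₀ => u (L.ψ k p) := fun k =>
      funext fun q => hH.step_eq_of_energyLevel_one_le (hu 1) k q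
    rw [stepWord_cons, h1]
    refine ih (u := u ∘ L.ψ i) fun n => ?_
    by_contra hcon
    have hn := hu (n + 1)
    rw [energyLevel_succ, ← hH.sum_energyZero_step] at hn
    simp only [h1] at hn
    refine not_lt.2 hn (Finset.sum_lt_sum (fun k _ => ?_) ⟨i, Finset.mem_univ i, ?_⟩)
    · refine mul_le_mul_of_nonneg_left ?_ (inv_nonneg.2 (H.r_pos k).le)
      have := H.energyLevel_mono (u ∘ L.ψ k) (Nat.zero_le n)
      simpa using this
    · exact mul_lt_mul_of_pos_left (not_le.1 hcon) (inv_pos.2 (H.r_pos i))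

variable [DiscreteTopology S]

/-- The harmonic function with boundary values `x`, as the limit of the iterated discrete harmonic
extensions. It agrees with `H.harmonicExt x`. -/
def harm (hH : H.IsComplete κ) (x : L.V₀ → ℝ) : C(K, ℝ) :=
  (L.exists_continuousMap_of_code (hH.continuous_codeValue x) (hH.codeValue_eq_of_π_eq x)).choose

lemma harm_π (hH : H.IsComplete κ) (x : L.V₀ → ℝ) (ω : ℕ → S) :
    hH.harm x (L.π ω) = hH.codeValue x ω :=
  (L.exists_continuousMap_of_code (hH.continuous_codeValue x)
    (hH.codeValue_eq_of_π_eq x)).choose_spec ω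

@[simp] lemma harm_boundary (hH : H.IsComplete κ) (x : L.V₀ → ℝ) (p : L.V₀) :
    hH.harm x p = x p := by
  obtain ⟨ω, hω⟩ := L.π_surjective p
  rw [← hω, harm_π, hH.codeValue_boundary x hω]

lemma harm_ψ (hH : H.IsComplete κ) (x : L.V₀ → ℝ) (i : S) (y : K) :
    hH.harm x (L.ψ i y) = hH.harm (hH.step i x) y := by
  obtain ⟨ω, rfl⟩ := L.π_surjective y
  rw [L.ψ_π, harm_π, harm_π, codeValue_prepend]

lemma harm_comp_ψ (hH : H.IsComplete κ) (x : L.V₀ → ℝ) (i : S) :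
    hH.harm x ∘ L.ψ i = hH.harm (hH.step i x) :=
  funext (hH.harm_ψ x i)

lemma harm_comp_ψw (hH : H.IsComplete κ) (x : L.V₀ → ℝ) (w : List S) :
    hH.harm x ∘ L.ψw w = hH.harm (hH.stepWord w x) := by
  induction w generalizing x with
  | nil => rfl
  | cons i w ih =>
    rw [stepWord_cons, ← ih, ← harm_comp_ψ]
    rfl

lemma harm_mem_Icc (hH : H.IsComplete κ) {x : L.V₀ → ℝ} {a b : ℝ} (hx : ∀ p, x p ∈ Set.Icc a b)
    (y : K) : hH.harm x y ∈ Set.Icc a b := by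
  obtain ⟨ω, rfl⟩ := L.π_surjective y
  rw [harm_π]
  exact isClosed_Icc.mem_of_tendsto (hH.tendsto_codeValue x ω (Classical.arbitrary _))
    (Eventually.of_forall fun n => hH.stepWord_mem_Icc hx _ _)

lemma harm_const (hH : H.IsComplete κ) (c : ℝ) (y : K) : hH.harm (fun _ => c) y = c := by
  have := hH.harm_mem_Icc (x := fun _ => c) (a := c) (b := c) (fun _ => ⟨le_rfl, le_rfl⟩) y
  exact le_antisymm this.2 this.1

lemma energyLevel_harm (hH : H.IsComplete κ) (n : ℕ) (x : L.V₀ → ℝ) :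
    energyLevel H.D H.r n (hH.harm x) (hH.harm x) = energyZero H.D x x := by
  induction n generalizing x with
  | zero => simp
  | succ n ih => simp_rw [energyLevel_succ, harm_comp_ψ, ih, hH.sum_energyZero_step]

lemma harm_mem_domain (hH : H.IsComplete κ) (x : L.V₀ → ℝ) : hH.harm x ∈ H.domain :=
  H.mem_domain_of_eventually_le 0 _ fun _ => (hH.energyLevel_harm _ x).le

lemma energy_harm (hH : H.IsComplete κ) (x : L.V₀ → ℝ) :
    H.energy (hH.harm x) (hH.harm x) = energyZero H.D x x :=
  tendsto_nhds_unique (H.energy_tendsto_self (hH.harm_mem_domain x))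
    (tendsto_const_nhds.congr fun n => (hH.energyLevel_harm n x).symm)

lemma isHarmonic_harm (hH : H.IsComplete κ) (x : L.V₀ → ℝ) : H.IsHarmonic (hH.harm x) := by
  refine ⟨hH.harm_mem_domain x, fun g hg hgx => ?_⟩
  rw [hH.energy_harm]
  refine le_trans (le_of_eq ?_) (H.energyLevel_le_energy hg 0)
  rw [energyLevel_zero, show (fun p : L.V₀ => g p) = x from
    funext fun p => by rw [hgx p p.2, harm_boundary]]

lemma eq_harm_of_isHarmonic (hH : H.IsComplete κ) {f : C(K, ℝ)} (hf : H.IsHarmonic f) :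
    f = hH.harm fun p => f p := by
  have hle : ∀ n, energyLevel H.D H.r n f f ≤ energyZero H.D (fun p => f p) (fun p => f p) := by
    intro n
    refine (H.energyLevel_le_energy hf.1 n).trans ?_
    rw [← hH.energy_harm]
    exact hf.2 _ (hH.harm_mem_domain _) fun p hp => hH.harm_boundary _ ⟨p, hp⟩
  ext y
  obtain ⟨ω, rfl⟩ := L.π_surjective y
  obtain ⟨p⟩ : Nonempty L.V₀ := inferInstance
  refine tendsto_nhds_unique ((f.continuous.tendsto _).comp (L.tendsto_ψw_prefixWord ω p)) ?_
  rw [harm_π]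
  refine (hH.tendsto_codeValue (fun p => f p) ω p).congr fun n => ?_
  exact (hH.stepWord_eq_of_energyLevel_le _ hle p).symm

lemma harmonicExt_eq (hH : H.IsComplete κ) (x : L.V₀ → ℝ) : H.harmonicExt x = hH.harm x := by
  have hx : ∃ h : C(K, ℝ), H.IsHarmonic h ∧ ∀ p : L.V₀, h p = x p :=
    ⟨hH.harm x, hH.isHarmonic_harm x, hH.harm_boundary x⟩
  rw [harmonicExt, dif_pos hx, hH.eq_harm_of_isHarmonic hx.choose_spec.1]
  congr 1
  exact funext hx.choose_spec.2

lemma A_eq_step (hH : H.IsComplete κ) (i : S) (x : L.V₀ → ℝ) : H.A i x = hH.step i x := by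
  funext p
  rw [A, hH.harmonicExt_eq, harm_ψ, harm_boundary]

lemma Aw_eq_stepWord (hH : H.IsComplete κ) (w : List S) (x : L.V₀ → ℝ) :
    H.Aw w x = hH.stepWord w x := by
  simp only [Aw, stepWord, hH.A_eq_step]

end IsComplete
end RegularHarmonicStructure

/-! ### Powers of a positive transition map -/

section Perron

variable {V : Type*} [Fintype V] {T : (V → ℝ) →ₗ[ℝ] (V → ℝ)} {p q₀ : V} {r : ℝ}

/-- Doeblin's condition: the entries of the row `q₀ ≠ p` of the positive map `T` are bounded
below. -/
lemma exists_doeblin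
    (hpos : ∀ x : V → ℝ, (∀ q, 0 ≤ x q) → ∀ s, 0 < x s → ∀ q, q ≠ p → 0 < T x q)
    (hq₀ : q₀ ≠ p) :
    ∃ δ, 0 < δ ∧ ∀ x : V → ℝ, (∀ q, 0 ≤ x q) → δ * ∑ q, x q ≤ T x q₀ := by
  classical
  have : Nonempty V := ⟨p⟩
  obtain ⟨s₀, hs₀⟩ := Finite.exists_min fun s => T (Pi.single s 1) q₀
  have hsingle : ∀ s : V, ∀ q, 0 ≤ (Pi.single s 1 : V → ℝ) q := fun s q => by
    rw [Pi.single_apply]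
    split_ifs <;> norm_num
  refine ⟨T (Pi.single s₀ 1) q₀, hpos _ (hsingle s₀) s₀ (by simp) q₀ hq₀, fun x hx => ?_⟩
  have hsum : T x q₀ = ∑ s, x s * T (Pi.single s 1) q₀ := by
    conv_lhs => rw [pi_eq_sum_univ' x]
    simp [map_sum, Finset.sum_apply]
  rw [hsum, mul_comm, Finset.sum_mul]
  exact Finset.sum_le_sum fun s _ => mul_le_mul_of_nonneg_left (hs₀ s) (hx s)

/-- On vectors of sum zero that vanish at `p`, a positive map whose columns off `p` have sum `r`
contracts the `ℓ¹` norm by a factor smaller than `r`. -/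
lemma exists_sum_abs_le (hmono : ∀ x : V → ℝ, (∀ q, 0 ≤ x q) → ∀ q, 0 ≤ T x q)
    (hpos : ∀ x : V → ℝ, (∀ q, 0 ≤ x q) → ∀ s, 0 < x s → ∀ q, q ≠ p → 0 < T x q)
    (hsum : ∀ x : V → ℝ, x p = 0 → ∑ q, T x q = r * ∑ q, x q) (hq₀ : q₀ ≠ p) :
    ∃ ρ, ρ < r ∧ ∀ x : V → ℝ, x p = 0 → ∑ q, x q = 0 → ∑ q, |T x q| ≤ ρ * ∑ q, |x q| := by
  classical
  obtain ⟨δ, hδ, hbound⟩ := exists_doeblin hpos hq₀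
  refine ⟨r - δ, by linarith, fun x hxp hx0 => ?_⟩
  let a : V → ℝ := fun q => max (x q) 0
  let b : V → ℝ := fun q => max (-x q) 0
  have ha : ∀ q, 0 ≤ a q := fun q => le_max_right _ _
  have hb : ∀ q, 0 ≤ b q := fun q => le_max_right _ _
  have hab : x = a - b := funext fun q => (max_zero_sub_eq_self (x q)).symm
  have habs : ∀ q, |x q| = a q + b q := fun q => (max_zero_add_max_neg_zero_eq_abs_self (x q)).symm
  have hsum_eq : ∑ q, a q = ∑ q, b q := by
    rw [hab] at hx0
    simpa [Finset.sum_sub_distrib, sub_eq_zero] using hx0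
  have hTx : ∀ q, T x q = T a q - T b q := fun q => by
    conv_lhs => rw [hab]
    rw [map_sub, Pi.sub_apply]
  have h0 := hbound a ha
  have h1 := hbound b hb
  have hle : ∀ q, |T x q| ≤ T a q + T b q - if q = q₀ then 2 * (δ * ∑ q, a q) else 0 := by
    intro q
    rw [hTx, abs_le]
    have h2 := hmono a ha q
    have h3 := hmono b hb q
    split_ifs with hq
    · subst hq
      rw [← hsum_eq] at h1
      constructor <;> linarith
    · constructor <;> linarith
  refine (Finset.sum_le_sum fun q _ => hle q).trans ?_
  rw [Finset.sum_sub_distrib, Finset.sum_add_distrib, hsum a (by simp [a, hxp]),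
    hsum b (by simp [b, hxp]), Finset.sum_ite_eq' Finset.univ q₀, if_pos (Finset.mem_univ _)]
  simp only [habs, Finset.sum_add_distrib, hsum_eq]
  linarith

/-- The Perron–Frobenius asymptotics of the powers of `T`: up to the fixed value at `p`, the
rescaled iterates converge to multiples of a single vector `v`. -/
lemma exists_tendsto_pow (hr : 0 < r) (hone : ∀ c : ℝ, T (fun _ => c) = fun _ => c)
    (hfix : ∀ x : V → ℝ, T x p = x p)
    (hmono : ∀ x : V → ℝ, (∀ q, 0 ≤ x q) → ∀ q, 0 ≤ T x q)
    (hpos : ∀ x : V → ℝ, (∀ q, 0 ≤ x q) → ∀ s, 0 < x s → ∀ q, q ≠ p → 0 < T x q)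
    (hsum : ∀ x : V → ℝ, x p = 0 → ∑ q, T x q = r * ∑ q, x q) (hq₀ : q₀ ≠ p) :
    ∃ v : V → ℝ, v p = 0 ∧ ∑ q, v q = 1 ∧ ∀ (x : V → ℝ) (q : V),
      Tendsto (fun n : ℕ => (r ^ n)⁻¹ * ((T ^ n) x q - x p)) atTop
        (𝓝 ((∑ q, (x q - x p)) * v q)) := by
  classical
  obtain ⟨ρ, hρ, hcontr⟩ := exists_sum_abs_le hmono hpos hsum hq₀
  have hpow_fix : ∀ n (x : V → ℝ), (T ^ n) x p = x p := by
    intro n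
    induction n with
    | zero => intro x; rfl
    | succ n ih => intro x; rw [pow_succ, Module.End.mul_apply, ih, hfix]
  have hpow_sum : ∀ n (x : V → ℝ), x p = 0 → ∑ q, (T ^ n) x q = r ^ n * ∑ q, x q := by
    intro n
    induction n with
    | zero => intro x _; simp
    | succ n ih =>
      intro x hx
      rw [pow_succ, Module.End.mul_apply, ih _ (by rw [hfix, hx]), hsum x hx, pow_succ, mul_assoc]
  have hpow_const : ∀ n (c : ℝ), (T ^ n) (fun _ => c) = fun _ => c := by
    intro n c
    induction n with
    | zero => rfl
    | succ n ih => rw [pow_succ, Module.End.mul_apply, hone, ih]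
  -- replacing `ρ` by a nonnegative number still smaller than `r`
  set θ := max ρ 0 with hθ
  have hθ0 : 0 ≤ θ := le_max_right _ _
  have hθr : θ / r < 1 := by rw [div_lt_one hr]; exact max_lt hρ hr
  have hdecay : ∀ n (x : V → ℝ), x p = 0 → ∑ q, x q = 0 →
      ∑ q, |(T ^ n) x q| ≤ θ ^ n * ∑ q, |x q| := by
    intro n
    induction n with
    | zero => intro x _ _; simp
    | succ n ih =>
      intro x hx h0
      rw [pow_succ, Module.End.mul_apply]
      refine (ih _ (by rw [hfix, hx]) (by rw [hsum x hx, h0, mul_zero])).trans ?_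
      rw [pow_succ, mul_assoc]
      refine mul_le_mul_of_nonneg_left ((hcontr x hx h0).trans ?_) (pow_nonneg hθ0 _)
      exact mul_le_mul_of_nonneg_right (le_max_left _ _) (Finset.sum_nonneg fun _ _ => abs_nonneg _)
  have hdecay' : ∀ n (x : V → ℝ), x p = 0 → ∑ q, x q = 0 → ∀ q,
      |(r ^ n)⁻¹ * (T ^ n) x q| ≤ (∑ q, |x q|) * (θ / r) ^ n := by
    intro n x hx h0 q
    rw [abs_mul, abs_of_pos (inv_pos.2 (pow_pos hr n)), div_pow, mul_div_assoc', div_eq_inv_mul]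
    refine mul_le_mul_of_nonneg_left ?_ (inv_pos.2 (pow_pos hr n)).le
    rw [mul_comm]
    exact (Finset.single_le_sum (f := fun q => |(T ^ n) x q|) (fun _ _ => abs_nonneg _)
      (Finset.mem_univ q)).trans (hdecay n x hx h0)
  let e : V → ℝ := Pi.single q₀ 1
  have hep : e p = 0 := Pi.single_eq_of_ne hq₀.symm _
  have hesum : ∑ q, e q = 1 := by simp [e]
  have hlim : ∀ q, ∃ c, Tendsto (fun n : ℕ => (r ^ n)⁻¹ * (T ^ n) e q) atTop (𝓝 c) := by
    intro q
    refine cauchySeq_tendsto_of_complete (cauchySeq_of_le_geometric (θ / r)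
      (∑ q, |(r⁻¹ • T e - e) q|) hθr fun n => ?_)
    have := hdecay' n (r⁻¹ • T e - e) (by simp [hfix, hep]) (by
      simp only [Pi.sub_apply, Pi.smul_apply, smul_eq_mul, Finset.sum_sub_distrib,
        ← Finset.mul_sum, hsum e hep, hesum]
      field_simp
      ring) q
    refine le_trans (le_of_eq ?_) this
    rw [dist_comm, Real.dist_eq, map_sub, map_smul, pow_succ, pow_succ, Module.End.mul_apply]
    simp only [Pi.sub_apply, Pi.smul_apply, smul_eq_mul, mul_inv]
    congr 1
    ring
  choose v hv using hlim
  refine ⟨v, ?_, ?_, fun x q => ?_⟩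
  · refine tendsto_nhds_unique (hv p) ?_
    simp [hpow_fix, hep]
  · refine tendsto_nhds_unique (tendsto_finsetSum _ fun q _ => hv q) ?_
    simp_rw [← Finset.mul_sum, hpow_sum _ e hep, hesum, mul_one]
    exact tendsto_const_nhds.congr fun n => (inv_mul_cancel₀ (pow_pos hr n).ne').symm
  · let y : V → ℝ := x - (fun _ => x p) - (∑ q, (x q - x p)) • e
    have hyp : y p = 0 := by simp [y, hep]
    have hysum : ∑ q, y q = 0 := by
      simp only [y, Pi.sub_apply, Pi.smul_apply, smul_eq_mul, Finset.sum_sub_distrib,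
        ← Finset.mul_sum, hesum]
      ring
    have hy : Tendsto (fun n : ℕ => (r ^ n)⁻¹ * (T ^ n) y q) atTop (𝓝 0) := by
      refine squeeze_zero_norm (fun n => hdecay' n y hyp hysum q) ?_
      simpa using (tendsto_pow_atTop_nhds_zero_of_lt_one (div_nonneg hθ0 hr.le) hθr).const_mul
        (∑ q, |y q|)
    have := hy.add ((hv q).const_mul (∑ q, (x q - x p)))
    rw [zero_add] at this
    refine this.congr fun n => ?_
    simp only [y, map_sub, map_smul, hpow_const, Pi.sub_apply, Pi.smul_apply, smul_eq_mul]
    ring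

end Perron

namespace RegularHarmonicStructure

open SelfSimilarStructure

variable {K S : Type*} [TopologicalSpace K] [TopologicalSpace S] [Fintype S] {L : PCFStructure K S}
  {H : RegularHarmonicStructure L} {κ : ℝ}

namespace IsComplete

lemma energyZero_affine (hH : H.IsComplete κ) (x : L.V₀ → ℝ) (a c : ℝ) :
    energyZero H.D (fun p => a * (x p - c)) (fun p => a * (x p - c)) =
      a ^ 2 * energyZero H.D x x := by
  have : ∀ p q, (a * (x p - c) - a * (x q - c)) * (a * (x p - c) - a * (x q - c)) =
      a ^ 2 * ((x p - x q) * (x p - x q)) := fun p q => by ring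
  simp only [hH.energyZero_eq, this, ← Finset.mul_sum]
  ring

lemma tendsto_energyZero (hH : H.IsComplete κ) {z : ℕ → L.V₀ → ℝ} {y : L.V₀ → ℝ}
    (h : ∀ p, Tendsto (fun n => z n p) atTop (𝓝 (y p))) :
    Tendsto (fun n => energyZero H.D (z n) (z n)) atTop (𝓝 (energyZero H.D y y)) := by
  simp_rw [hH.energyZero_eq]
  exact (tendsto_finsetSum _ fun p _ => tendsto_finsetSum _ fun q _ =>
    ((h p).sub (h q)).mul ((h p).sub (h q))).const_mul _

variable [CompactSpace K] [T2Space K] [PreconnectedSpace K] [Nontrivial L.V₀]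

lemma stepWord_replicate (hH : H.IsComplete κ) (n : ℕ) (j : S) (x : L.V₀ → ℝ) :
    hH.stepWord (List.replicate n j) x = (hH.step j ^ n) x := by
  induction n generalizing x with
  | zero => rfl
  | succ n ih => rw [List.replicate_succ, stepWord_cons, ih, pow_succ, Module.End.mul_apply]

/-- Near a boundary point, all harmonic functions have asymptotically proportional energies, in the
proportion of their squared normal derivatives. -/
lemma exists_tendsto_energyZero (hH : H.IsComplete κ) {j : S} {p : L.V₀} (hp : L.ψ j p = p) :
    ∃ c, 0 < c ∧ ∀ x : L.V₀ → ℝ, Tendsto (fun n : ℕ => ((H.r j ^ n)⁻¹) ^ 2 *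
      energyZero H.D (hH.stepWord (List.replicate n j) x) (hH.stepWord (List.replicate n j) x))
      atTop (𝓝 ((∑ q, (x q - x p)) ^ 2 * c)) := by
  obtain ⟨q₀, hq₀⟩ := exists_ne p
  obtain ⟨v, hvp, hvsum, hv⟩ := exists_tendsto_pow (T := hH.step j) (p := p) (H.r_pos j)
    (hH.step_const j) (fun x => hH.step_fixed x hp) (fun x hx => hH.step_nonneg hx j)
    (fun x hx s hs q hq => hH.step_pos hx hs hp hq) (fun x hx => by
      have := hH.sum_step_sub x hp
      simp only [hH.step_fixed x hp, hx, zero_sub, Finset.sum_neg_distrib] at this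
      linarith) hq₀
  refine ⟨energyZero H.D v v, ?_, fun x => ?_⟩
  · refine lt_of_le_of_ne (H.energyZero_self_nonneg v) fun h => ?_
    have h0 : ∀ q, v q = 0 := fun q => (hH.eq_of_energyZero_eq_zero h.symm q p).trans hvp
    simp [h0] at hvsum
  · have h1 := hH.energyZero_affine v (∑ q, (x q - x p)) 0
    simp only [sub_zero] at h1
    rw [← h1]
    refine (hH.tendsto_energyZero fun q => hv x q).congr fun n => ?_
    rw [hH.energyZero_affine, stepWord_replicate]

end IsComplete
end RegularHarmonicStructure

/-! ### Existence of energy measures -/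

section Riesz

/-- Uniformly bounded positive functionals on `C(K)` have a limit point, and it is given by a
measure: the limit is taken along an ultrafilter and represented by the Riesz–Markov–Kakutani
theorem. -/
lemma exists_measure_of_tendsto {K : Type*} [TopologicalSpace K] [CompactSpace K] [T2Space K]
    [MeasurableSpace K] [BorelSpace K] (G : ℕ → C(K, ℝ) → ℝ)
    (hadd : ∀ n g g', G n (g + g') = G n g + G n g') (hsmul : ∀ n (c : ℝ) g, G n (c • g) = c * G n g)
    (hmono : ∀ n g g', g ≤ g' → G n g ≤ G n g') {B : ℝ} (hone : ∀ n, G n 1 ≤ B) :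
    ∃ μ : Measure K, IsFiniteMeasure μ ∧ ∀ (g : C(K, ℝ)) (c : ℝ),
      Tendsto (fun n => G n g) atTop (𝓝 c) → ∫ x, g x ∂μ = c := by
  have hzero : ∀ n, G n 0 = 0 := fun n => by simpa using hsmul n 0 0
  have hbound : ∀ n g, G n g ∈ Set.Icc (-‖g‖ * B) (‖g‖ * B) := by
    intro n g
    have h0 : 0 ≤ ‖g‖ := norm_nonneg g
    have h1 : G n g ≤ G n (‖g‖ • 1) := hmono n _ _ fun y => by
      simpa using (abs_le.1 (g.norm_coe_le_norm y)).2
    have h2 : G n (-‖g‖ • 1) ≤ G n g := hmono n _ _ fun y => by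
      simpa using (abs_le.1 (g.norm_coe_le_norm y)).1
    rw [hsmul] at h1 h2
    have h3 := mul_le_mul_of_nonneg_left (hone n) h0
    constructor <;> linarith
  have hle : (hyperfilter ℕ : Filter ℕ) ≤ atTop := by
    rw [← Nat.cofinite_eq_atTop]
    exact hyperfilter_le_cofinite
  have hlim : ∀ g, ∃ c, Tendsto (fun n => G n g) (hyperfilter ℕ : Filter ℕ) (𝓝 c) := by
    intro g
    obtain ⟨c, -, hc⟩ := isCompact_Icc.ultrafilter_le_nhds'
      ((hyperfilter ℕ).map fun n => G n g) (Ultrafilter.mem_map.2 (univ_mem' fun n => hbound n g))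
    exact ⟨c, hc⟩
  choose Λ hΛ using hlim
  let Λ' : CompactlySupportedContinuousMap K ℝ →ₚ[ℝ] ℝ := PositiveLinearMap.mk₀
    { toFun := fun g => Λ g
      map_add' := fun g g' => tendsto_nhds_unique (hΛ _)
        (((hΛ g).add (hΛ g')).congr fun n => (hadd n _ _).symm)
      map_smul' := fun c g => tendsto_nhds_unique (hΛ _)
        (((hΛ g).const_mul c).congr fun n => (hsmul n _ _).symm) }
    fun g hg => ge_of_tendsto' (hΛ g) fun n => by
      rw [← hzero n]
      exact hmono n _ _ hg
  refine ⟨RealRMK.rieszMeasure Λ', inferInstance, fun g c hc => ?_⟩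
  have h := RealRMK.integral_rieszMeasure Λ'
    (CompactlySupportedContinuousMap.continuousMapEquiv g)
  exact h.trans (tendsto_nhds_unique (hΛ g) (hc.mono_left hle))

end Riesz

namespace SelfSimilarStructure

variable {K S : Type*} [TopologicalSpace K] [TopologicalSpace S] (L : SelfSimilarStructure K S)

/-- Continuous functions on the level-one cells that agree on common points glue. -/
lemma exists_continuousMap_glue [CompactSpace K] [T2Space K] [Finite S] [DiscreteTopology S]
    (g : S → C(K, ℝ)) (hg : ∀ i j x y, i ≠ j → L.ψ i x = L.ψ j y → g i x = g j y) :
    ∃ f : C(K, ℝ), ∀ i y, f (L.ψ i y) = g i y := by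
  have hc : Continuous fun z : S × K => g z.1 z.2 :=
    continuous_prod_of_discrete_left.2 fun i => (g i).continuous
  have hF : Continuous fun ω : ℕ → S => g (ω 0) (L.π fun k => ω (k + 1)) :=
    hc.comp (f := fun ω : ℕ → S => (ω 0, L.π fun k => ω (k + 1))) ((continuous_apply 0).prodMk
      (L.π_continuous.comp (continuous_pi fun k => continuous_apply (k + 1))))
  obtain ⟨f, hf⟩ := L.exists_continuousMap_of_code hF fun ω τ h => by
    rw [← prepend_head_tail ω, ← prepend_head_tail τ, ← L.ψ_π, ← L.ψ_π] at h
    by_cases h0 : ω 0 = τ 0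
    · rw [h0] at h ⊢
      rw [L.ψ_injective _ h]
    · exact hg _ _ _ _ h0 h
  refine ⟨f, fun i y => ?_⟩
  obtain ⟨ω, rfl⟩ := L.π_surjective y
  rw [L.ψ_π, hf]
  rfl

end SelfSimilarStructure

namespace RegularHarmonicStructure

open SelfSimilarStructure

variable {K S : Type*} [TopologicalSpace K] [TopologicalSpace S] [Fintype S] {L : PCFStructure K S}
  {H : RegularHarmonicStructure L} {κ : ℝ}

lemma mem_domain_of_comp_ψ {g : C(K, ℝ)} {g' : S → C(K, ℝ)} (hg' : ∀ i, g' i ∈ H.domain)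
    (hg : ∀ i y, g (L.ψ i y) = g' i y) : g ∈ H.domain := by
  refine H.mem_domain_of_eventually_le 1 (∑ i, (H.r i)⁻¹ * H.energy (g' i) (g' i)) fun n => ?_
  rw [add_comm, energyLevel_succ]
  refine Finset.sum_le_sum fun i _ => mul_le_mul_of_nonneg_left ?_ (inv_nonneg.2 (H.r_pos i).le)
  rw [show g ∘ L.ψ i = g' i from funext (hg i)]
  exact H.energyLevel_le_energy (hg' i) n

namespace IsComplete

variable [CompactSpace K] [T2Space K]

lemma exists_isEnergyMeasure [MeasurableSpace K] [BorelSpace K] (hH : H.IsComplete κ)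
    {f : C(K, ℝ)} (hf : f ∈ H.domain) : ∃ μ, H.IsEnergyMeasure f μ := by
  obtain ⟨μ, hμ, h⟩ := exists_measure_of_tendsto (fun n g => H.carre κ n f g)
    (fun n g g' => carre_add_right n f g g') (fun n c g => carre_smul_right n f g c)
    (fun n g g' hgg' => hH.carre_mono n f hgg') (B := 2 * H.energy f f)
    (fun n => by
      have := H.energyLevel_le_energy hf n
      rw [ContinuousMap.coe_one, hH.carre_one_right]
      linarith)
  exact ⟨μ, hμ, fun g hg => h g _ (hH.tendsto_carre hf hg)⟩

lemma isEnergyMeasure_energyMeasure [MeasurableSpace K] [BorelSpace K] (hH : H.IsComplete κ)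
    {f : C(K, ℝ)} (hf : f ∈ H.domain) : H.IsEnergyMeasure f (H.energyMeasure f) := by
  have h := hH.exists_isEnergyMeasure hf
  rw [energyMeasure, dif_pos h]
  exact h.choose_spec

/-! ### The energy measure of a cell -/

variable [PreconnectedSpace K]

/-- Piecewise harmonic functions of level `M`: every function `a` on `V_M` extends to a function of
finite energy that is harmonic on each cell of level `M`. -/
lemma exists_piecewise_harm [DiscreteTopology S] [Nonempty L.V₀] (hH : H.IsComplete κ) (M : ℕ)
    (a : K → ℝ) : ∃ g ∈ H.domain, (∀ p : L.V₀, g p = a p) ∧ ∀ w : List S, w.length = M → ∀ y,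
      g (L.ψw w y) = hH.harm (fun p => a (L.ψw w p)) y := by
  induction M generalizing a with
  | zero =>
    refine ⟨hH.harm fun p => a p, hH.harm_mem_domain _, fun p => by simp, fun w hw y => ?_⟩
    obtain rfl := List.length_eq_zero_iff.1 hw
    rfl
  | succ M ih =>
    choose g' hg' hg'V hg'w using fun i => ih (a ∘ L.ψ i)
    obtain ⟨g, hg⟩ := L.exists_continuousMap_glue g' fun i j x y hij h => by
      rw [hg'V i ⟨x, L.mem_V₀_of_ψ_eq hij h⟩, hg'V j ⟨y, L.mem_V₀_of_ψ_eq hij.symm h.symm⟩]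
      exact congrArg a h
    refine ⟨g, mem_domain_of_comp_ψ hg' hg, fun p => ?_, fun w hw y => ?_⟩
    · obtain ⟨j, hj⟩ := hH.fixed p p.2
      have h1 : g (L.ψ j p) = a (L.ψ j p) := (hg j p).trans (hg'V j p)
      rwa [hj] at h1
    · cases w with
      | nil => simp at hw
      | cons i w =>
        rw [ψw_cons, hg, hg'w i w (by simpa using hw)]
        rfl

/-- The energy of a harmonic function is the sum of the energies on the cells of any level. -/
lemma wordSum_energyZero_stepWord [Nonempty L.V₀] (hH : H.IsComplete κ) (n : ℕ) (x : L.V₀ → ℝ) :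
    (wordSum n fun w => (wordProd H.r w)⁻¹ *
      energyZero H.D (hH.stepWord w x) (hH.stepWord w x)) = energyZero H.D x x := by
  induction n generalizing x with
  | zero => simp
  | succ n ih =>
    simp_rw [wordSum_succ, wordProd_cons, stepWord_cons, mul_inv, mul_assoc, wordSum_mul, ih,
      hH.sum_energyZero_step]

/-- The energy of a harmonic function on the cells that shrink to a boundary point tends to `0`. -/
lemma tendsto_energy_replicate [Nontrivial L.V₀] (hH : H.IsComplete κ) {j : S} {p : L.V₀}
    (hp : L.ψ j p = p) (x : L.V₀ → ℝ) : Tendsto (fun n : ℕ => (H.r j ^ n)⁻¹ *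
      energyZero H.D (hH.stepWord (List.replicate n j) x) (hH.stepWord (List.replicate n j) x))
      atTop (𝓝 0) := by
  obtain ⟨c, -, hc⟩ := hH.exists_tendsto_energyZero hp
  have := (tendsto_pow_atTop_nhds_zero_of_lt_one (H.r_pos j).le (H.r_lt_one j)).mul (hc x)
  rw [zero_mul] at this
  refine this.congr fun n => ?_
  have := (pow_pos (H.r_pos j) n).ne'
  field_simp

lemma wordSum_ite_eq {S : Type*} [Fintype S] [DecidableEq S] {n : ℕ} {u₀ : List S} {c : ℝ}
    (hn : u₀.length = n) : (wordSum n fun u => if u = u₀ then c else 0) = c := by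
  subst hn
  rw [wordSum, Finset.sum_eq_single u₀.get]
  · simp
  · intro v _ hv
    refine if_neg fun h => hv (List.ofFn_injective ?_)
    rw [h, List.ofFn_get]
  · simp

end IsComplete
end RegularHarmonicStructure

namespace SelfSimilarStructure

variable {K S : Type*} [TopologicalSpace K] [TopologicalSpace S] (L : SelfSimilarStructure K S)

lemma isClosed_cell [CompactSpace K] [T2Space K] (w : List S) : IsClosed (L.cell w) :=
  (isCompact_range (L.ψw_continuous w)).isClosed

end SelfSimilarStructure

namespace RegularHarmonicStructure

open SelfSimilarStructure

variable {K S : Type*} [TopologicalSpace K] [TopologicalSpace S] [Fintype S] {L : PCFStructure K S}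
  {H : RegularHarmonicStructure L} {κ : ℝ}

namespace IsComplete

variable [CompactSpace K] [T2Space K] [PreconnectedSpace K] [DiscreteTopology S]

/-- The piecewise harmonic cut-off function of level `|w| + k` with value `1` at the vertices of
`K_w` and `0` at all other vertices of that level. -/
def cutoff [Nonempty L.V₀] (hH : H.IsComplete κ) (w : List S) (k : ℕ) : C(K, ℝ) :=
  (hH.exists_piecewise_harm (w.length + k) (Set.indicator (L.cell w) 1)).choose

section Cutoff

variable [Nonempty L.V₀]

lemma cutoff_mem_domain (hH : H.IsComplete κ) (w : List S) (k : ℕ) : hH.cutoff w k ∈ H.domain :=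
  (hH.exists_piecewise_harm (w.length + k) (Set.indicator (L.cell w) 1)).choose_spec.1

lemma cutoff_ψw (hH : H.IsComplete κ) (w : List S) (k : ℕ) {v : List S}
    (hv : v.length = w.length + k) (y : K) : hH.cutoff w k (L.ψw v y) =
      hH.harm (fun p => Set.indicator (L.cell w) 1 (L.ψw v p)) y :=
  (hH.exists_piecewise_harm (w.length + k) (Set.indicator (L.cell w) 1)).choose_spec.2.2 v hv y

lemma cutoff_mem_Icc (hH : H.IsComplete κ) (w : List S) (k : ℕ) (y : K) :
    hH.cutoff w k y ∈ Set.Icc (0 : ℝ) 1 := by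
  obtain ⟨v, z, hv, rfl⟩ := L.exists_ψw_eq (w.length + k) y
  rw [hH.cutoff_ψw w k hv]
  refine hH.harm_mem_Icc (fun p => ?_) z
  by_cases hp : L.ψw v p ∈ L.cell w
  · rw [Set.indicator_of_mem hp]; simp
  · rw [Set.indicator_of_notMem hp]; simp

lemma cutoff_eq_one (hH : H.IsComplete κ) (w : List S) (k : ℕ) (y : K) :
    hH.cutoff w k (L.ψw w y) = 1 := by
  obtain ⟨u, z, hu, rfl⟩ := L.exists_ψw_eq k y
  rw [← L.ψw_append, hH.cutoff_ψw w k (by simp [hu])]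
  simp_rw [L.ψw_append]
  rw [show (fun p : L.V₀ => Set.indicator (L.cell w) (1 : K → ℝ) (L.ψw w (L.ψw u p))) =
    fun _ => 1 from funext fun p =>
      Set.indicator_of_mem (show L.ψw w (L.ψw u p) ∈ L.cell w from ⟨_, rfl⟩) _]
  exact hH.harm_const 1 z

lemma cutoff_comp_eq_zero (hH : H.IsComplete κ) (w : List S) (k : ℕ) {v : List S}
    (hv : v.length = w.length + k) (h : ∀ p : L.V₀, L.ψw v p ∉ L.cell w) (y : K) :
    hH.cutoff w k (L.ψw v y) = 0 := by
  rw [hH.cutoff_ψw w k hv, show (fun p : L.V₀ => Set.indicator (L.cell w) (1 : K → ℝ) (L.ψw v p)) =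
    fun _ => 0 from funext fun p => Set.indicator_of_notMem (h p) _]
  exact hH.harm_const 0 y

lemma tendsto_cutoff (hH : H.IsComplete κ) (w : List S) (y : K) :
    Tendsto (fun k => hH.cutoff w k y) atTop (𝓝 (Set.indicator (L.cell w) 1 y)) := by
  by_cases hy : y ∈ L.cell w
  · obtain ⟨z, rfl⟩ := hy
    simp_rw [hH.cutoff_eq_one]
    rw [Set.indicator_of_mem (show L.ψw w z ∈ L.cell w from ⟨z, rfl⟩)]
    exact tendsto_const_nhds
  · rw [Set.indicator_of_notMem hy]
    obtain ⟨ω, rfl⟩ := L.π_surjective y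
    have hev : ∀ᶠ n in atTop, ∀ p : L.V₀, L.ψw (prefixWord n ω) p ∉ L.cell w :=
      eventually_all.2 fun p => (L.tendsto_ψw_prefixWord ω p).eventually
        ((L.isClosed_cell w).isOpen_compl.mem_nhds hy)
    refine tendsto_const_nhds.congr' ?_
    filter_upwards [(tendsto_add_atTop_nat w.length).eventually hev] with k hk
    have hω : L.π ω = L.ψw (prefixWord (k + w.length) ω) (L.π fun m => ω (m + (k + w.length))) := by
      rw [L.ψw_π]
      congr 1
      funext m
      rcases lt_or_ge m (k + w.length) with h | h
      · exact (prependWord_prefixWord_of_lt h _ _).symm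
      · obtain ⟨l, rfl⟩ := Nat.exists_eq_add_of_le' h
        have := prependWord_add_length (prefixWord (k + w.length) ω)
          (fun m => ω (m + (k + w.length))) l
        rw [length_prefixWord] at this
        exact this.symm
    rw [hω]
    exact (hH.cutoff_comp_eq_zero w k (by simp [add_comm]) hk _).symm

end Cutoff

variable [Nontrivial L.V₀]

lemma carre_harm_le (hH : H.IsComplete κ) (n : ℕ) (x : L.V₀ → ℝ) {g : K → ℝ} (hg : ∀ y, g y ≤ 1) :
    H.carre κ n (hH.harm x) g ≤ 2 * energyZero H.D x x := by
  refine (hH.carre_mono n _ (g' := 1) hg).trans ?_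
  rw [hH.carre_one_right, hH.energyLevel_harm]

/-- The energy measure of a harmonic function on the cell `K_w` is twice the energy of its
restriction to the cell. It is tested with the cut-off functions of level `|w| + k`; apart from
`K_w` itself these charge only cells of that level that shrink to boundary points of the other
cells of level `|w|`. -/
lemma measureReal_cell [MeasurableSpace K] [BorelSpace K] (hH : H.IsComplete κ) (x : L.V₀ → ℝ)
    {μ : Measure K} (hμ : H.IsEnergyMeasure (hH.harm x) μ) (w : List S) :
    μ.real (L.cell w) =
      2 * ((wordProd H.r w)⁻¹ * energyZero H.D (hH.stepWord w x) (hH.stepWord w x)) := by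
  classical
  have hfin := hμ.1
  set m := w.length with hm
  let E : List S → ℝ := fun v =>
    (wordProd H.r v)⁻¹ * energyZero H.D (hH.stepWord v x) (hH.stepWord v x)
  have hE0 : ∀ v, 0 ≤ E v := fun v =>
    mul_nonneg (inv_nonneg.2 (H.wordProd_pos v).le) (H.energyZero_self_nonneg _)
  have hEadd : ∀ v k, (wordSum k fun u => E (v ++ u)) = E v := fun v k => by
    simp only [E, wordProd_append, stepWord_append, mul_inv, mul_assoc, wordSum_mul,
      hH.wordSum_energyZero_stepWord]
  -- the cells that shrink to boundary points of cells other than `K_w`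
  let err : ℕ → ℝ := fun k => wordSum m fun v => ∑ j : S,
    if ∃ p : L.V₀, L.ψ j p = p then 2 * E (v ++ List.replicate k j) else 0
  have herr : Tendsto err atTop (𝓝 0) := by
    have hterm : ∀ (v : List S) (j : S), Tendsto (fun k =>
        if ∃ p : L.V₀, L.ψ j p = p then 2 * E (v ++ List.replicate k j) else 0) atTop (𝓝 0) := by
      intro v j
      split_ifs with hj
      · obtain ⟨p, hp⟩ := hj
        have := (hH.tendsto_energy_replicate hp (hH.stepWord v x)).const_mul
          (2 * (wordProd H.r v)⁻¹)
        rw [mul_zero] at this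
        refine this.congr fun k => ?_
        simp only [E, wordProd_append, wordProd_replicate, stepWord_append, mul_inv, mul_assoc]
      · exact tendsto_const_nhds
    have := tendsto_finsetSum (Finset.univ : Finset (Fin m → S)) fun v _ =>
      tendsto_finsetSum (Finset.univ : Finset S) fun j _ => hterm (List.ofFn v) j
    simp only [Finset.sum_const_zero] at this
    exact this
  have hlim : ∀ k, Tendsto (fun n => H.carre κ n (hH.harm x) (hH.cutoff w k)) atTop
      (𝓝 (∫ y, hH.cutoff w k y ∂μ)) := fun k => by
    rw [hμ.2 _ (hH.cutoff_mem_domain w k)]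
    exact hH.tendsto_carre (hH.harm_mem_domain x) (hH.cutoff_mem_domain w k)
  have hint : Tendsto (fun k => ∫ y, hH.cutoff w k y ∂μ) atTop (𝓝 (μ.real (L.cell w))) := by
    rw [← integral_indicator_one (L.isClosed_cell w).measurableSet]
    refine tendsto_integral_of_dominated_convergence (fun _ => 1)
      (fun k => (hH.cutoff w k).continuous.aestronglyMeasurable) (integrable_const _)
      (fun k => Eventually.of_forall fun y => ?_)
      (Eventually.of_forall fun y => hH.tendsto_cutoff w y)
    have := hH.cutoff_mem_Icc w k y
    rw [Real.norm_eq_abs, abs_of_nonneg this.1]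
    exact this.2
  have hcell : ∀ v n (g : K → ℝ), (wordProd H.r v)⁻¹ * H.carre κ n (hH.harm x ∘ L.ψw v) g =
      (wordProd H.r v)⁻¹ * H.carre κ n (hH.harm (hH.stepWord v x)) g := fun v n g => by
    rw [hH.harm_comp_ψw]
  have hcell_le : ∀ v n (g : K → ℝ), (∀ y, g y ≤ 1) →
      (wordProd H.r v)⁻¹ * H.carre κ n (hH.harm x ∘ L.ψw v) g ≤ 2 * E v := fun v n g hg => by
    rw [hcell]
    have := mul_le_mul_of_nonneg_left (hH.carre_harm_le n (hH.stepWord v x) hg)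
      (inv_nonneg.2 (H.wordProd_pos v).le)
    simp only [E]
    linarith
  have hcell_nonneg : ∀ v n (g : K → ℝ), (∀ y, 0 ≤ g y) →
      0 ≤ (wordProd H.r v)⁻¹ * H.carre κ n (hH.harm x ∘ L.ψw v) g := fun v n g hg => by
    refine mul_nonneg (inv_nonneg.2 (H.wordProd_pos v).le) ?_
    rw [← carre_zero_right (H := H) (κ := κ) n (hH.harm x ∘ L.ψw v)]
    exact hH.carre_mono n _ hg
  have hlower : ∀ k, 2 * E w ≤ ∫ y, hH.cutoff w k y ∂μ := by
    intro k
    refine ge_of_tendsto (hlim k) ?_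
    filter_upwards [eventually_ge_atTop m] with n hn
    obtain ⟨n, rfl⟩ := Nat.exists_eq_add_of_le hn
    rw [carre_add_length]
    refine le_trans (le_of_eq ?_) (le_wordSum (fun v => hcell_nonneg v n _ fun y =>
      (hH.cutoff_mem_Icc w k _).1) w)
    rw [hcell, show (fun y => hH.cutoff w k (L.ψw w y)) = 1 from funext (hH.cutoff_eq_one w k),
      hH.carre_one_right, hH.energyLevel_harm]
    ring
  have hupper : ∀ k, ∫ y, hH.cutoff w k y ∂μ ≤ 2 * E w + err k := by
    intro k
    refine le_of_tendsto (hlim k) ?_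
    filter_upwards [eventually_ge_atTop (m + k)] with n hn
    obtain ⟨n, rfl⟩ := Nat.exists_eq_add_of_le hn
    rw [carre_add_length, wordSum_add_length, ← wordSum_ite_eq (c := 2 * E w) hm.symm,
      ← wordSum_add]
    refine wordSum_le fun v hv => ?_
    have herr0 : ∀ j, 0 ≤ if ∃ p : L.V₀, L.ψ j p = p then 2 * E (v ++ List.replicate k j) else 0 :=
      fun j => by split_ifs; exacts [mul_nonneg two_pos.le (hE0 _), le_rfl]
    by_cases hvw : v = w
    · rw [if_pos hvw, ← hEadd, ← hvw, ← wordSum_mul]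
      refine le_add_of_le_of_nonneg (wordSum_le fun u hu => ?_)
        (Finset.sum_nonneg fun j _ => herr0 j)
      exact hcell_le _ n _ fun y => (hH.cutoff_mem_Icc _ k _).2
    · rw [if_neg hvw, zero_add]
      have hle : (wordSum k fun u => (wordProd H.r (v ++ u))⁻¹ * H.carre κ n
          (hH.harm x ∘ L.ψw (v ++ u)) (hH.cutoff w k ∘ L.ψw (v ++ u))) ≤
          wordSum k fun u => ∑ j : S, if u = List.replicate k j then
            (if ∃ p : L.V₀, L.ψ j p = p then 2 * E (v ++ List.replicate k j) else 0) else 0 := by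
        refine wordSum_le fun u hu => ?_
        have hlen : (v ++ u).length = w.length + k := by rw [List.length_append, hv, hu]
        have hnn : ∀ j, 0 ≤ if u = List.replicate k j then
            (if ∃ p : L.V₀, L.ψ j p = p then 2 * E (v ++ List.replicate k j) else 0) else 0 :=
          fun j => by split_ifs; exacts [mul_nonneg two_pos.le (hE0 _), le_rfl, le_rfl]
        by_cases hmeet : ∃ p : L.V₀, L.ψw (v ++ u) p ∈ L.cell w
        · obtain ⟨p, z, hz⟩ := hmeet
          rw [L.ψw_append] at hz
          obtain ⟨j, hj⟩ := hH.fixed _ (L.mem_V₀_of_ψw_eq hv hvw hz.symm)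
          have huj : u = List.replicate k j := hu ▸ L.eq_replicate_of_ψw_eq_fixed hj rfl
          refine le_trans ?_ (Finset.single_le_sum (fun j _ => hnn j) (Finset.mem_univ j))
          rw [if_pos huj, if_pos ⟨⟨_, L.mem_V₀_of_ψw_eq hv hvw hz.symm⟩, hj⟩, ← huj]
          exact hcell_le _ n _ fun y => (hH.cutoff_mem_Icc _ k _).2
        · refine le_trans (le_of_eq ?_) (Finset.sum_nonneg fun j _ => hnn j)
          rw [show (hH.cutoff w k : K → ℝ) ∘ L.ψw (v ++ u) = 0 from
            funext (hH.cutoff_comp_eq_zero w k hlen fun p hp => hmeet ⟨p, hp⟩),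
            carre_zero_right, mul_zero]
      refine hle.trans (le_of_eq ?_)
      rw [wordSum, Finset.sum_comm]
      exact Finset.sum_congr rfl fun j _ => wordSum_ite_eq (by simp)
  refine tendsto_nhds_unique hint (tendsto_of_tendsto_of_tendsto_of_le_of_le tendsto_const_nhds
    ?_ hlower hupper)
  simpa using herr.const_add (2 * E w)

end IsComplete
end RegularHarmonicStructure

/-! ### The matrix `D` -/

/-- The assumption that `S₀` has as many elements as `V₀` makes `V₀ → S₀` a bijection. -/
lemma PCFStructure.exists_equiv_fixed {K S : Type*} [TopologicalSpace K] [TopologicalSpace S]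
    [T2Space K] (L : PCFStructure K S) {S₀ : Finset S} (hcard : S₀.card = Fintype.card L.V₀)
    (hfix : ∀ p ∈ L.V₀, ∃ j ∈ S₀, L.ψ j p = p) : ∃ e : L.V₀ ≃ S₀, ∀ p, L.ψ (e p) p = p := by
  choose φ hφ hφp using fun p : L.V₀ => hfix p p.2
  have hinj : Function.Injective fun p => (⟨φ p, hφ p⟩ : S₀) := fun p q hpq => by
    have h : φ p = φ q := congrArg Subtype.val hpq
    exact Subtype.ext (L.fixed_unique (hφp p) (h ▸ hφp q))
  exact ⟨Equiv.ofBijective _ ((Fintype.bijective_iff_injective_and_card _).2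
    ⟨hinj, by rw [Fintype.card_coe, hcard]⟩), hφp⟩

/-- A symmetric matrix with kernel the constants and `D² = -γ D` is the Laplacian of the complete
graph with constant conductance: `D + γ` maps into the kernel of `D`, so its columns are constant. -/
lemma exists_conductance {V : Type*} [Fintype V] [Nonempty V] {D : Matrix V V ℝ} (hsymm : D.IsSymm)
    (hker : ∀ x : V → ℝ, D.mulVec x = 0 ↔ ∃ c : ℝ, ∀ p, x p = c) {γ : ℝ} (hγ : 0 < γ)
    (hD : D * D = (-γ) • D) :
    ∃ κ, 0 < κ ∧ ∀ (x : V → ℝ) (p : V), D.mulVec x p = κ * ∑ q, (x q - x p) := by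
  classical
  have hcol : ∀ q, ∃ c : ℝ, ∀ p,
      (D.mulVec (Pi.single q 1) + γ • Pi.single q 1 : V → ℝ) p = c := fun q => by
    refine (hker _).1 ?_
    rw [Matrix.mulVec_add, Matrix.mulVec_mulVec, hD, Matrix.smul_mulVec, Matrix.mulVec_smul,
      neg_smul, neg_add_cancel]
  choose c hc using hcol
  have hentry : ∀ p q, D p q + γ * (if p = q then 1 else 0) = c q := fun p q => by
    have := hc q p
    simpa [Pi.single_apply] using this
  have hcc : ∀ p q, c p = c q := fun p q => by
    rw [← hentry q p, ← hentry p q, hsymm.apply p q]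
    simp only [eq_comm]
  obtain ⟨p₀⟩ : Nonempty V := inferInstance
  have hrow : (Fintype.card V : ℝ) * c p₀ = γ := by
    have h0 : D.mulVec (fun _ => 1) p₀ = 0 := by
      rw [(hker _).2 ⟨1, fun _ => rfl⟩, Pi.zero_apply]
    have h1 : ∑ q, (D p₀ q + γ * (if p₀ = q then 1 else 0)) = ∑ _q : V, c p₀ :=
      Finset.sum_congr rfl fun q _ => (hentry p₀ q).trans (hcc q p₀)
    rw [Finset.sum_add_distrib, ← Finset.mul_sum, Finset.sum_ite_eq, if_pos (Finset.mem_univ _),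
      Finset.sum_const, Finset.card_univ, nsmul_eq_mul] at h1
    simp only [Matrix.mulVec, dotProduct, mul_one] at h0
    rw [← h1, h0]
    ring
  have hcard : (0 : ℝ) < Fintype.card V := by exact_mod_cast Fintype.card_pos
  refine ⟨c p₀, pos_of_mul_pos_right (hrow ▸ hγ) hcard.le, fun x p => ?_⟩
  have h2 : ∀ q, D p q * x q = c p₀ * x q - if p = q then γ * x q else 0 := fun q => by
    rw [← hcc q p₀, ← hentry p q]
    split_ifs <;> ring
  simp only [Matrix.mulVec, dotProduct, h2, Finset.sum_sub_distrib, Finset.sum_ite_eq,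
    Finset.mem_univ, if_true, ← Finset.mul_sum, Finset.sum_const, Finset.card_univ, nsmul_eq_mul]
  rw [← hrow]
  ring

namespace RegularHarmonicStructure

open SelfSimilarStructure

variable {K S : Type*} [TopologicalSpace K] [TopologicalSpace S] [Fintype S] {L : PCFStructure K S}
  {H : RegularHarmonicStructure L} {κ : ℝ}

lemma isComplete_of_mulVec (hκ : 0 < κ)
    (hD : ∀ (x : L.V₀ → ℝ) (p : L.V₀), H.D.mulVec x p = κ * ∑ q, (x q - x p))
    (hfix : ∀ p ∈ L.V₀, ∃ j, L.ψ j p = p) : H.IsComplete κ := by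
  refine ⟨hκ, fun x y => ?_, hfix⟩
  have h1 : ∑ p, ∑ q, (x p - x q) * (y p - y q) =
      ∑ p, ∑ q, (x p - x q) * y p - ∑ p, ∑ q, (x p - x q) * y q := by
    simp only [mul_sub, Finset.sum_sub_distrib]
  have h2 : ∑ p, ∑ q, (x p - x q) * y q = -∑ p, ∑ q, (x p - x q) * y p := by
    rw [Finset.sum_comm, ← Finset.sum_neg_distrib]
    refine Finset.sum_congr rfl fun p _ => ?_
    rw [← Finset.sum_neg_distrib]
    exact Finset.sum_congr rfl fun q _ => by ring
  have h3 : energyZero H.D x y = κ * ∑ p, ∑ q, (x p - x q) * y p := by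
    simp only [energyZero, dotProduct, Pi.neg_apply, hD, Finset.mul_sum]
    refine Finset.sum_congr rfl fun p _ => ?_
    rw [← Finset.sum_neg_distrib, Finset.sum_mul]
    exact Finset.sum_congr rfl fun q _ => by ring
  rw [h1, h2, h3]
  ring

lemma energyZero_eq_sum_sq {γ : ℝ} (hγ : 0 < γ) (hD : H.D * H.D = (-γ) • H.D) (x : L.V₀ → ℝ) :
    energyZero H.D x x = γ⁻¹ * ∑ p, H.D.mulVec x p ^ 2 := by
  have h1 : ∑ p, H.D.mulVec x p ^ 2 = H.D.mulVec x ⬝ᵥ H.D.mulVec x :=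
    Finset.sum_congr rfl fun p _ => sq _
  rw [h1, Matrix.dotProduct_mulVec, ← Matrix.mulVec_transpose, H.D_symm.eq, Matrix.mulVec_mulVec,
    hD, Matrix.smul_mulVec, smul_dotProduct, energyZero, neg_dotProduct, smul_eq_mul]
  field_simp

lemma u_dotProduct [T2Space K] {j : S} {p : L.V₀} (hp : L.ψ j p = p) (x : L.V₀ → ℝ) :
    H.u j ⬝ᵥ x = H.D.mulVec x p := by
  have hj : ∃ p : L.V₀, L.ψ j p = p := ⟨p, hp⟩
  have hpp : hj.choose = p := Subtype.ext (L.fixed_unique hj.choose_spec hp)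
  rw [u, dif_pos hj, hpp]
  exact Finset.sum_congr rfl fun q _ => congrArg (· * x q) (H.D_symm.apply p q)

namespace IsComplete

variable [CompactSpace K] [T2Space K] [PreconnectedSpace K]

lemma stepWord_add [Nonempty L.V₀] (hH : H.IsComplete κ) (w : List S) (x y : L.V₀ → ℝ) :
    hH.stepWord w (x + y) = hH.stepWord w x + hH.stepWord w y := by
  induction w generalizing x y with
  | nil => rfl
  | cons i w ih => simp only [stepWord_cons, map_add, ih]

lemma stepWord_smul [Nonempty L.V₀] (hH : H.IsComplete κ) (w : List S) (c : ℝ) (x : L.V₀ → ℝ) :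
    hH.stepWord w (c • x) = c • hH.stepWord w x := by
  induction w generalizing x with
  | nil => rfl
  | cons i w ih => simp only [stepWord_cons, map_smul, ih]

lemma stepWord_const [Nonempty L.V₀] (hH : H.IsComplete κ) (w : List S) (c : ℝ) :
    hH.stepWord w (fun _ => c) = fun _ => c := by
  induction w with
  | nil => rfl
  | cons i w ih => rw [stepWord_cons, step_const, ih]

lemma stepWord_surjective [Nonempty L.V₀] [DiscreteTopology S] (hH : H.IsComplete κ)
    (hA : ∀ i, Function.Bijective (H.A i)) (w : List S) : Function.Surjective (hH.stepWord w) := by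
  induction w with
  | nil => exact Function.surjective_id
  | cons i w ih =>
    refine ih.comp (g := hH.stepWord w) fun y => ?_
    obtain ⟨x, hx⟩ := (hA i).2 y
    exact ⟨x, by rw [← hx, hH.A_eq_step]⟩

variable [DiscreteTopology S] [Nontrivial L.V₀] [MeasurableSpace K] [BorelSpace K]

lemma energyMeasure_real_cell (hH : H.IsComplete κ) {f : C(K, ℝ)} (hf : H.IsHarmonic f)
    (w : List S) : (H.energyMeasure f).real (L.cell w) = 2 * ((wordProd H.r w)⁻¹ *
      energyZero H.D (hH.stepWord w fun p => f p) (hH.stepWord w fun p => f p)) := by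
  have h := hH.isEnergyMeasure_energyMeasure hf.1
  refine hH.measureReal_cell (fun p => f p) ?_ w
  rwa [← hH.eq_harm_of_isHarmonic hf]

lemma sumMeasure_real_cell (hH : H.IsComplete κ) {N : ℕ} {h : Fin N → C(K, ℝ)}
    (hh : ∀ k, H.IsHarmonic (h k)) (w : List S) :
    (H.sumMeasure h).real (L.cell w) = 2 * ((wordProd H.r w)⁻¹ *
      ∑ k, energyZero H.D (hH.stepWord w fun p => h k p) (hH.stepWord w fun p => h k p)) := by
  have hfin : ∀ k, IsFiniteMeasure (H.energyMeasure (h k)) := fun k =>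
    (hH.isEnergyMeasure_energyMeasure (hh k).1).1
  rw [sumMeasure, Measure.real, Measure.finsetSum_apply,
    ENNReal.toReal_sum fun k _ => measure_ne_top _ _, Finset.mul_sum, Finset.mul_sum]
  exact Finset.sum_congr rfl fun k _ => hH.energyMeasure_real_cell (hh k) w

lemma ratio_eq (hH : H.IsComplete κ) {N : ℕ} {h : Fin N → C(K, ℝ)}
    (hh : ∀ k, H.IsHarmonic (h k)) {f : C(K, ℝ)} (hf : H.IsHarmonic f) (w : List S) :
    H.ratio h f w = energyZero H.D (hH.stepWord w fun p => f p) (hH.stepWord w fun p => f p) /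
      ∑ k, energyZero H.D (hH.stepWord w fun p => h k p) (hH.stepWord w fun p => h k p) := by
  have hr := (H.wordProd_pos w).ne'
  rw [ratio, hH.energyMeasure_real_cell hf, hH.sumMeasure_real_cell hh,
    mul_div_mul_left _ _ two_ne_zero, mul_div_mul_left _ _ (inv_ne_zero hr)]

/-- The density at `w j^∞` is the quotient of the squared normal derivatives. -/
lemma tendsto_ratio (hH : H.IsComplete κ)
    (hD : ∀ (x : L.V₀ → ℝ) (p : L.V₀), H.D.mulVec x p = κ * ∑ q, (x q - x p)) {N : ℕ}
    {h : Fin N → C(K, ℝ)} (hh : ∀ k, H.IsHarmonic (h k)) {f : C(K, ℝ)} (hf : H.IsHarmonic f)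
    (w : List S) {j : S} {p : L.V₀} (hp : L.ψ j p = p) (ha : H.a h w j ≠ 0) :
    Tendsto (fun n : ℕ => H.ratio h f (w ++ List.replicate n j)) atTop
      (𝓝 ((H.u j ⬝ᵥ H.Aw w fun p => f p) ^ 2 / H.a h w j)) := by
  obtain ⟨c, hc, hlim⟩ := hH.exists_tendsto_energyZero hp
  have hu : ∀ x : L.V₀ → ℝ, (∑ q, (x q - x p)) ^ 2 * c = c / κ ^ 2 * (H.u j ⬝ᵥ x) ^ 2 := fun x => by
    have := hH.pos.ne'
    rw [u_dotProduct hp, hD]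
    field_simp
  have hc' : c / κ ^ 2 ≠ 0 := (div_pos hc (pow_pos hH.pos 2)).ne'
  have hden := tendsto_finsetSum Finset.univ fun k _ => hlim (hH.stepWord w fun p => h k p)
  have haE : ∑ k, (∑ q, ((hH.stepWord w fun p => h k p) q - (hH.stepWord w fun p => h k p) p)) ^ 2
      * c = c / κ ^ 2 * H.a h w j := by
    simp only [hu, a, hH.Aw_eq_stepWord, Finset.mul_sum]
  rw [haE] at hden
  have := (hlim (hH.stepWord w fun p => f p)).div hden (mul_ne_zero hc' ha)
  rw [hu, mul_div_mul_left _ _ hc', ← hH.Aw_eq_stepWord] at this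
  refine this.congr fun n => ?_
  have hr := (pow_pos (inv_pos.2 (pow_pos (H.r_pos j) n)) 2).ne'
  rw [hH.ratio_eq hh hf, Pi.div_apply, ← Finset.mul_sum, mul_div_mul_left _ _ hr]
  simp only [stepWord_append, hH.Aw_eq_stepWord]

end IsComplete

end RegularHarmonicStructure

/-! ### Uniqueness of the weights and conclusion -/

/-- The squares of the linear forms `y ↦ ∑ q, (y q - y p)`, `p ∈ V`, are linearly independent if
`V` has at least three points: testing with `e_p - e_q` gives `c_p + c_q = 0` for all `p ≠ q`. -/
lemma eq_zero_of_forall_sum_sq_eq_zero {V : Type*} [Fintype V] (hV : 3 ≤ Fintype.card V)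
    {c : V → ℝ} (hc : ∀ y : V → ℝ, ∑ p, c p * (∑ q, (y q - y p)) ^ 2 = 0) (p : V) : c p = 0 := by
  classical
  have hpair : ∀ p q, p ≠ q → c p + c q = 0 := by
    intro p q hpq
    have h := hc (Pi.single p 1 - Pi.single q 1)
    have hn : (Fintype.card V : ℝ) ^ 2 ≠ 0 := by
      have : (Fintype.card V : ℝ) ≠ 0 := by exact_mod_cast (by omega : Fintype.card V ≠ 0)
      exact pow_ne_zero 2 this
    have hval : ∀ s, c s * (∑ t, ((Pi.single p 1 - Pi.single q 1 : V → ℝ) t -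
        (Pi.single p 1 - Pi.single q 1 : V → ℝ) s)) ^ 2 =
        (Fintype.card V : ℝ) ^ 2 * ((if s = p then c s else 0) + if s = q then c s else 0) := by
      intro s
      simp only [Finset.sum_sub_distrib, Pi.sub_apply, Finset.sum_const, Finset.card_univ,
        Pi.single_apply, Finset.sum_ite_eq', Finset.mem_univ, if_true, sub_self, zero_sub,
        nsmul_eq_mul]
      by_cases h1 : s = p
      · subst h1
        rw [if_pos rfl, if_pos rfl, if_neg hpq, if_neg hpq]
        ring
      · by_cases h2 : s = q
        · subst h2
          rw [if_pos rfl, if_pos rfl, if_neg h1, if_neg h1]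
          ring
        · rw [if_neg h1, if_neg h1, if_neg h2, if_neg h2]
          ring
    simp only [hval, ← Finset.mul_sum, Finset.sum_add_distrib, Finset.sum_ite_eq',
      Finset.mem_univ, if_true] at h
    exact (mul_eq_zero.1 h).resolve_left hn
  obtain ⟨a, b, d, hab, had, hbd⟩ := Fintype.two_lt_card_iff.1 (by omega : 2 < Fintype.card V)
  have h1 := hpair a b hab
  have h2 := hpair a d had
  have h3 := hpair b d hbd
  by_cases hp : p = a
  · rw [hp]; linarith
  · have := hpair p a hp
    linarith

namespace RegularHarmonicStructure

open SelfSimilarStructure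

variable {K S : Type*} [TopologicalSpace K] [TopologicalSpace S] [Fintype S] {L : PCFStructure K S}
  {H : RegularHarmonicStructure L} {κ : ℝ}

namespace IsComplete

variable [CompactSpace K] [T2Space K] [PreconnectedSpace K] [DiscreteTopology S]
  [Nontrivial L.V₀]

/-- Since the `h_k` span the harmonic functions modulo constants and `A_w` is onto, some `A_w h_k`
is not orthogonal to `u_j`. -/
lemma a_pos (hH : H.IsComplete κ)
    (hD : ∀ (x : L.V₀ → ℝ) (p : L.V₀), H.D.mulVec x p = κ * ∑ q, (x q - x p))
    (hA : ∀ i, Function.Bijective (H.A i)) {N : ℕ} {h : Fin N → C(K, ℝ)}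
    (hspan : (Submodule.span ℝ (insert (1 : C(K, ℝ)) (Set.range h)) : Set C(K, ℝ)) =
      {f | H.IsHarmonic f}) (w : List S) {j : S} {p : L.V₀} (hp : L.ψ j p = p) :
    0 < H.a h w j := by
  classical
  refine lt_of_le_of_ne (Finset.sum_nonneg fun k _ => sq_nonneg _) fun hzero => ?_
  have hk : ∀ k, H.u j ⬝ᵥ hH.stepWord w (fun p => h k p) = 0 := fun k => by
    have := (Finset.sum_eq_zero_iff_of_nonneg fun k _ => sq_nonneg _).1 hzero.symm k
      (Finset.mem_univ k)
    rw [← hH.Aw_eq_stepWord]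
    exact pow_eq_zero_iff two_ne_zero |>.1 this
  let ℓ : C(K, ℝ) →ₗ[ℝ] ℝ :=
    { toFun := fun f => H.u j ⬝ᵥ hH.stepWord w fun p => f p
      map_add' := fun f g => by
        rw [show (fun p : L.V₀ => (f + g) p) = (fun p : L.V₀ => f p) + fun p : L.V₀ => g p from rfl,
          hH.stepWord_add, dotProduct_add]
      map_smul' := fun c f => by
        rw [show (fun p : L.V₀ => (c • f) p) = c • fun p : L.V₀ => f p from rfl,
          hH.stepWord_smul, dotProduct_smul, RingHom.id_apply] }
  have hle : Submodule.span ℝ (insert (1 : C(K, ℝ)) (Set.range h)) ≤ LinearMap.ker ℓ := by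
    rw [Submodule.span_le, Set.insert_subset_iff]
    constructor
    · change H.u j ⬝ᵥ hH.stepWord w (fun _ => 1) = 0
      rw [hH.stepWord_const, u_dotProduct hp, hD]
      simp
    · rintro _ ⟨k, rfl⟩
      exact hk k
  obtain ⟨q₀, hq₀⟩ := exists_ne p
  obtain ⟨x, hx⟩ := hH.stepWord_surjective hA w (Pi.single q₀ 1)
  have hmem : hH.harm x ∈ (Submodule.span ℝ (insert (1 : C(K, ℝ)) (Set.range h)) : Set C(K, ℝ)) :=
    hspan ▸ hH.isHarmonic_harm x
  have h0 : H.u j ⬝ᵥ hH.stepWord w (fun p => hH.harm x p) = 0 := hle hmem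
  simp only [harm_boundary] at h0
  rw [hx, u_dotProduct hp, hD] at h0
  simp [Pi.single_eq_of_ne hq₀.symm, hH.pos.ne'] at h0

end IsComplete

end RegularHarmonicStructure

end FractalEnergy
end

open FractalEnergy FractalEnergy.RegularHarmonicStructure in
theorem mainTheorem3 {K S : Type*}
    [TopologicalSpace K] [CompactSpace K] [ConnectedSpace K] [TopologicalSpace.MetrizableSpace K]
    [MeasurableSpace K] [BorelSpace K]
    [Fintype S] [TopologicalSpace S] [DiscreteTopology S] (hS : 2 ≤ Fintype.card S)
    (L : FractalEnergy.PCFStructure K S) (H : FractalEnergy.RegularHarmonicStructure L)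
    (S₀ : Finset S)
    (hA1_card : S₀.card = Fintype.card L.V₀)
    (hA1_fixed : ∀ p ∈ L.V₀, ∃ j ∈ S₀, L.ψ j p = p)
    (hA1_connected : ∀ p ∈ L.V₀, IsConnected ({p}ᶜ : Set K))
    (hA2 : ∀ i, Function.Bijective (H.A i))
    (hA3 : ∃ γ : ℝ, 0 < γ ∧ H.D * H.D = (-γ) • H.D)
    {N : ℕ} (h : Fin N → C(K, ℝ))
    (hspan : (Submodule.span ℝ (insert (1 : C(K, ℝ)) (Set.range h)) : Set C(K, ℝ)) =
      {f | H.IsHarmonic f})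
    (w : List S) :
    0 < (H.sumMeasure h).real (L.cell w) ∧
    (∀ f, H.IsHarmonic f → ∀ j ∈ S₀,
      Tendsto (fun n : ℕ => H.ratio h f (w ++ List.replicate n j)) atTop
        (𝓝 (H.density h f w j))) ∧
    ∃ b : S → ℝ,
      (∀ j ∈ S₀, 0 < b j) ∧
      (∀ j ∈ S₀, b j = H.a h w j / ∑ i ∈ S₀, H.a h w i) ∧
      (∀ f, H.IsHarmonic f → H.ratio h f w = ∑ j ∈ S₀, b j * H.density h f w j) ∧
      (3 ≤ Fintype.card L.V₀ →
        ∀ b' : S → ℝ,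
          (∀ f, H.IsHarmonic f → H.ratio h f w = ∑ j ∈ S₀, b' j * H.density h f w j) →
          ∀ j ∈ S₀, b' j = b j) := by
  have hSnt : Nontrivial S := Fintype.one_lt_card_iff_nontrivial.1 hS
  have hfix : ∀ p ∈ L.V₀, ∃ j, L.ψ j p = p := fun p hp =>
    let ⟨j, _, hj⟩ := hA1_fixed p hp
    ⟨j, hj⟩
  have hVnt : Nontrivial L.V₀ := L.nontrivial_V₀ hfix
  obtain ⟨γ, hγ, hDD⟩ := hA3
  obtain ⟨κ, hκ, hD⟩ := exists_conductance H.D_symm H.D_ker hγ hDD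
  have hH : H.IsComplete κ := isComplete_of_mulVec hκ hD hfix
  obtain ⟨e, he⟩ := L.exists_equiv_fixed hA1_card hA1_fixed
  have hfixS : ∀ j ∈ S₀, ∃ p : L.V₀, L.ψ j p = p := fun j hj =>
    ⟨e.symm ⟨j, hj⟩, by simpa using he (e.symm ⟨j, hj⟩)⟩
  have hh : ∀ k, H.IsHarmonic (h k) := fun k => by
    have : h k ∈ (Submodule.span ℝ (insert (1 : C(K, ℝ)) (Set.range h)) : Set C(K, ℝ)) :=
      Submodule.subset_span (Set.mem_insert_of_mem _ ⟨k, rfl⟩)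
    rwa [hspan] at this
  have ha : ∀ j ∈ S₀, 0 < H.a h w j := fun j hj =>
    let ⟨_, hp⟩ := hfixS j hj
    hH.a_pos hD hA2 hspan w hp
  have hS₀ : S₀.Nonempty := by
    obtain ⟨p⟩ : Nonempty L.V₀ := inferInstance
    exact ⟨e p, (e p).2⟩
  have hasum : 0 < ∑ i ∈ S₀, H.a h w i := Finset.sum_pos ha hS₀
  have hlim : ∀ f, H.IsHarmonic f → ∀ j ∈ S₀,
      Tendsto (fun n : ℕ => H.ratio h f (w ++ List.replicate n j)) atTop
        (𝓝 ((H.u j ⬝ᵥ H.Aw w fun p => f p) ^ 2 / H.a h w j)) := fun f hf j hj =>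
    let ⟨_, hp⟩ := hfixS j hj
    hH.tendsto_ratio hD hh hf w hp (ha j hj).ne'
  have hdens : ∀ f, H.IsHarmonic f → ∀ j ∈ S₀,
      H.density h f w j = (H.u j ⬝ᵥ H.Aw w fun p => f p) ^ 2 / H.a h w j := fun f hf j hj =>
    (hlim f hf j hj).limUnder_eq
  -- the energy of boundary values is the sum of their squared normal derivatives
  have hsum : ∀ F : S → ℝ, ∑ j ∈ S₀, F j = ∑ p, F (e p) := fun F => by
    rw [← Finset.sum_coe_sort, ← e.sum_comp]
  have hE : ∀ x : L.V₀ → ℝ, energyZero H.D x x = γ⁻¹ * ∑ j ∈ S₀, (H.u j ⬝ᵥ x) ^ 2 := fun x => by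
    rw [energyZero_eq_sum_sq hγ hDD, hsum]
    simp only [u_dotProduct (he _)]
  have hEh : ∑ k, energyZero H.D (hH.stepWord w fun p => h k p) (hH.stepWord w fun p => h k p) =
      γ⁻¹ * ∑ j ∈ S₀, H.a h w j := by
    simp only [hE, ← Finset.mul_sum, a, hH.Aw_eq_stepWord]
    rw [Finset.sum_comm]
  have hratio : ∀ f, H.IsHarmonic f → H.ratio h f w =
      (∑ j ∈ S₀, (H.u j ⬝ᵥ H.Aw w fun p => f p) ^ 2) / ∑ j ∈ S₀, H.a h w j := fun f hf => by
    rw [hH.ratio_eq hh hf, hEh, hE, mul_div_mul_left _ _ (inv_pos.2 hγ).ne', hH.Aw_eq_stepWord]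
  have hrepr : ∀ f, H.IsHarmonic f → H.ratio h f w =
      ∑ j ∈ S₀, (H.a h w j / ∑ i ∈ S₀, H.a h w i) * H.density h f w j := fun f hf => by
    rw [hratio f hf, Finset.sum_div]
    refine Finset.sum_congr rfl fun j hj => ?_
    have := (ha j hj).ne'
    rw [hdens f hf j hj]
    field_simp
  refine ⟨?_, fun f hf j hj => ?_, fun j => H.a h w j / ∑ i ∈ S₀, H.a h w i,
    fun j hj => div_pos (ha j hj) hasum, fun j _ => rfl, hrepr, fun hcard b' hb' => ?_⟩
  · rw [hH.sumMeasure_real_cell hh, hEh]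
    exact mul_pos two_pos (mul_pos (inv_pos.2 (H.wordProd_pos w)) (mul_pos (inv_pos.2 hγ) hasum))
  · rw [hdens f hf j hj]
    exact hlim f hf j hj
  · -- the difference of two families of weights gives a relation between the squares of the `u_j`
    have hrel : ∀ y : L.V₀ → ℝ, ∑ p, ((b' (e p) - H.a h w (e p) / ∑ i ∈ S₀, H.a h w i) /
        H.a h w (e p)) * (∑ q, (y q - y p)) ^ 2 = 0 := by
      intro y
      obtain ⟨x, hx⟩ := hH.stepWord_surjective hA2 w y
      have hf := hH.isHarmonic_harm x
      have h1 := (hb' _ hf).symm.trans (hrepr _ hf)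
      rw [hsum, hsum, ← sub_eq_zero, ← Finset.sum_sub_distrib] at h1
      have h2 : ∀ p, b' (e p) * H.density h (hH.harm x) w (e p) -
          H.a h w (e p) / (∑ i ∈ S₀, H.a h w i) * H.density h (hH.harm x) w (e p) =
          κ ^ 2 * (((b' (e p) - H.a h w (e p) / ∑ i ∈ S₀, H.a h w i) /
            H.a h w (e p)) * (∑ q, (y q - y p)) ^ 2) := fun p => by
        rw [hdens _ hf _ (e p).2, hH.Aw_eq_stepWord]
        simp only [IsComplete.harm_boundary]
        rw [hx, u_dotProduct (he p), hD]
        ring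
      simp only [h2, ← Finset.mul_sum] at h1
      exact (mul_eq_zero.1 h1).resolve_left (pow_pos hκ 2).ne'
    intro j hj
    have h0 := eq_zero_of_forall_sum_sq_eq_zero hcard hrel (e.symm ⟨j, hj⟩)
    rw [Equiv.apply_symm_apply] at h0
    exact sub_eq_zero.1 ((div_eq_zero_iff.1 h0).resolve_right (ha j hj).ne')
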